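/- Let $N$ be the real nilpotent matrix in upper Jordan form (ones above the diagonal) with blocks of sizes $d_1,\dots,d_q\ge 1$, let $n=d_1+\dots+d_q$, and let $M,H$ be real $n\times n$ matrices with $H^*=H$ (where $*$ denotes transpose) such that $(N,M,H)$ is an $\mathfrak{sl}_2$ triad: $[N,M]=H$, $[H,N]=2N$, $[H,M]=-2M$. For an $n\times n$ matrix $A$, put $\mathcal D_A f=f'(\mathbf x)A\mathbf x$ for $f\in\mathbb R[[\mathbf x]]=\mathbb R[[x_1,\dots,x_n]]$ and $L_A\mathbf v=\mathbf v'(\mathbf x)A\mathbf x-A\mathbf v(\mathbf x)$ for formal vector fields $\mathbf v\in\mathbb R[[\mathbf x]]^n$. Let $\mathcal X=\mathcal D_{N^*}$, $\mathcal Y=\mathcal D_{M^*}$, $\mathcal Z=\mathcal D_{H}$, let $\mathcal J=\ker\mathcal X$ be the algebra of formal invariants and $\mathcal E=\ker L_{N^*}$ the module of formal equivariants. A family in a space of formal power series or of formal vector fields is called a *formal vector space basis* of a subspace if its members lie in the subspace, it is linearly independent, and every element of the subspace is in a unique way a (possibly infinite) formal linear combination of the family, that is, one in which each coefficient of the sum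 receives only finitely many nonzero contributions. Let $\alpha=(\alpha_1,\dots,\alpha_p)$ be a Hilbert basis for $\mathcal J$: each $\alpha_i$ is a homogeneous polynomial in $\ker\mathcal X$ and an eigenvector of $\mathcal Z$, and every polynomial in $\ker\mathcal X$ is a polynomial in $\alpha_1,\dots,\alpha_p$. Let $A\subset\mathbb N^p$ be (the set of exponents of) a preferred set: the monomials $\alpha^{\mathbf k}=\alpha_1^{k_1}\cdots\alpha_p^{k_p}$, $\mathbf k\in A$, form a formal vector space basis of $\mathcal J$. For $j=1,\dots,q$ let $\mathbf b_j=\mathbf e_r$, where $r$ is the number of the bottom row of the $j$-th Jordan block, so that $\mathbf B=(\mathbf b_1,\dots,\mathbf b_q)$ is a basis of $\ker N^*$, the top space of the triad $(-N^*,-M^*,-H)$ on $\mathbb R^n$. The weight $\widehat f$ of $f=\alpha^{\mathbf k}$ is its eigenvalue under $\mathcal Z$, and the weight $\widehat{\mathbf w}$ of $\mathbf w=\mathbf b_j$ is its eigenvalue under $-H$; these weights are nonnegative integers. For integers $0\le s\le\min(\widehat f,\widehat{\mathbf w})$ define the transvectant $$(f,\mathbf w)^{(s)}=\sum_{j=0}^{s}(-1)^j\binom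 sj\frac{(\widehat f-j)!}{(\widehat f-s)!}\,\frac{(\widehat{\mathbf w}-s+j)!}{(\widehat{\mathbf w}-s)!}\,(\mathcal Y^jf)\,\bigl((-M^*)^{s-j}\mathbf w\bigr).$$ **Theorem.** The family $A\mathbin{\widehat\boxtimes}\mathbf B$ of all admissible transvectants $(\alpha^{\mathbf k},\mathbf b_j)^{(s)}$, with $\mathbf k\in A$, $1\le j\le q$ and $0\le s\le\min(\widehat{\alpha^{\mathbf k}},\widehat{\mathbf b_j})$, is a formal vector space basis of $\mathcal E$. -/

import Mathlib

noncomputable section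

namespace Boosting

/-- `(X, Y, Z)` is an `sl₂` triad of square matrices:
`[X, Y] = Z`, `[Z, X] = 2X`, `[Z, Y] = -2Y`. -/
structure IsTriad {ι : Type*} [Fintype ι] (X Y Z : Matrix ι ι ℝ) : Prop where
  comm_XY : X * Y - Y * X = Z
  comm_ZX : Z * X - X * Z = (2 : ℝ) • X
  comm_ZY : Z * Y - Y * Z = (-2 : ℝ) • Y

/-- The coordinates of `ℝⁿ`, `n = d₁ + ⋯ + d_q`, grouped according to blocks of sizes
`d₁, …, d_q`: the coordinate `⟨j, a⟩` is the `a`-th row (counted from `0`) of the `j`-th block. -/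
abbrev Coord {q : ℕ} (d : Fin q → ℕ) : Type := Σ j : Fin q, Fin (d j)

/-- The nilpotent upper Jordan block of size `m`: ones just above the diagonal. -/
def jordanBlock (m : ℕ) : Matrix (Fin m) (Fin m) ℝ :=
  Matrix.of fun a b => if (a : ℕ) + 1 = (b : ℕ) then 1 else 0

/-- The nilpotent matrix in upper Jordan form with blocks of sizes `d₁, …, d_q`. -/
def jordanN {q : ℕ} (d : Fin q → ℕ) : Matrix (Coord d) (Coord d) ℝ :=
  Matrix.blockDiagonal' fun j => jordanBlock (d j)

/-- The vector `b_j`: the standard basis vector `e_r`, `r` the bottom row of the `j`-th block. -/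
def bottom {q : ℕ} (d : Fin q → ℕ) (hd : ∀ j, 0 < d j) (j : Fin q) : Coord d → ℝ :=
  Pi.single ⟨j, ⟨d j - 1, Nat.sub_lt (hd j) Nat.one_pos⟩⟩ 1

section General

variable {ι : Type*} [Fintype ι]

/-- Formal vector fields on `ℝ^ι`. -/
abbrev FormalVF (ι : Type*) : Type _ := ι → MvPowerSeries ι ℝ

/-- The directional derivative `𝒟_A f = f'(x) A x` on formal power series. -/
def dirDeriv [DecidableEq ι] (A : Matrix ι ι ℝ) :
    Derivation ℝ (MvPowerSeries ι ℝ) (MvPowerSeries ι ℝ) :=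
  ∑ i, (∑ j, A i j • (MvPowerSeries.X j : MvPowerSeries ι ℝ)) • MvPowerSeries.pderiv ℝ i

/-- `𝒟_A` as a linear endomorphism of the space of formal power series. -/
abbrev opD [DecidableEq ι] (A : Matrix ι ι ℝ) : Module.End ℝ (MvPowerSeries ι ℝ) :=
  (dirDeriv A).toLinearMap

/-- The Lie operator `L_A v = v'(x) A x - A v(x)` on formal vector fields. -/
def lieOp [DecidableEq ι] (A : Matrix ι ι ℝ) : Module.End ℝ (FormalVF ι) where
  toFun v := fun i => dirDeriv A (v i) - ∑ j, A i j • v j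
  map_add' v w := by
    funext i
    simp only [Pi.add_apply, map_add, smul_add, Finset.sum_add_distrib]
    abel
  map_smul' c v := by
    funext i
    simp only [Pi.smul_apply, Derivation.map_smul, RingHom.id_apply, smul_sub, Finset.smul_sum]
    simp only [smul_comm c]

/-- The weight of a top weight vector `v` of a triad whose third member is `T`: the eigenvalue of
`v`, that is, the (for `v ≠ 0` unique) natural number `w` with `T v = w v`.
(Weights of nonzero top weight vectors are natural numbers; for a vector without such
a `w` the value `0` has no meaning.) -/
def weight {V : Type*} [AddCommGroup V] [Module ℝ V] (T : Module.End ℝ V) (v : V) : ℕ :=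
  sInf {w : ℕ | T v = (w : ℝ) • v}

/-- The coefficient `W^{sj} = C(s,j) · (a-j)!/(a-s)! · (b-s+j)!/(b-s)!` for weights `a`, `b`. -/
def coeffW (a b s j : ℕ) : ℝ :=
  (s.choose j : ℝ) * (((a - j).factorial : ℝ) / ((a - s).factorial : ℝ)) *
    (((b - s + j).factorial : ℝ) / ((b - s).factorial : ℝ))

/-- The external transvectant
`(f, w)^{(s)} = ∑_{j=0}^{s} (-1)^j W^{sj} (𝒴^j f) ((-M*)^{s-j} w)`, where `𝒴 = 𝒟_{M*}`, the weight
of `f` is taken with respect to `𝒵 = 𝒟_H` and the weight of `w` with respect to `-H`. It is used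
only for `s` at most both weights. -/
def transvectant [DecidableEq ι] (M H : Matrix ι ι ℝ)
    (f : MvPowerSeries ι ℝ) (w : ι → ℝ) (s : ℕ) : FormalVF ι :=
  fun i => ∑ j ∈ Finset.range (s + 1),
    ((-1 : ℝ) ^ j * coeffW (weight (opD H) f) (weight (Matrix.toLin' (-H)) w) s j *
      (((-M.transpose) ^ (s - j)).mulVec w i)) • ((opD M.transpose) ^ j) f

/-- `x` is the formal (in particular, possibly infinite) linear combination `∑ i, c i • v i`:
with respect to the given coefficient functionals, each coefficient of the sum
has only finitely many nonzero contributions, and they add up to the coefficient of `x`. -/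
def IsFormalComb {K I V : Type*} [AddCommGroup V] [Module ℝ V] (coef : K → V →ₗ[ℝ] ℝ)
    (v : I → V) (c : I → ℝ) (x : V) : Prop :=
  ∀ m : K, (Function.support fun i => c i * coef m (v i)).Finite ∧
    coef m x = ∑ᶠ i, c i * coef m (v i)

/-- The family `v` is a formal vector space basis of the subspace `E`: its members lie in `E`, it is
linearly independent, and every element of `E` is in a unique way a formal (countable)
linear combination of the family. -/
structure IsFormalBasis {K I V : Type*} [AddCommGroup V] [Module ℝ V] (coef : K → V →ₗ[ℝ] ℝ)
    (v : I → V) (E : Submodule ℝ V) : Prop where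
  mem : ∀ i, v i ∈ E
  linearIndependent : LinearIndependent ℝ v
  existsUnique_comb : ∀ x ∈ E, ∃! c : I → ℝ, IsFormalComb coef v c x

/-- The coefficient functionals on formal power series. -/
def scalarCoeff (m : ι →₀ ℕ) : MvPowerSeries ι ℝ →ₗ[ℝ] ℝ := MvPowerSeries.coeff m

/-- The coefficient functionals on formal vector fields: a component and a monomial. -/
def vectorCoeff (m : ι × (ι →₀ ℕ)) : FormalVF ι →ₗ[ℝ] ℝ :=
  (MvPowerSeries.coeff m.2).comp (LinearMap.proj m.1)

/-- The monomial `α^k = α₁^{k₁} ⋯ α_p^{k_p}`, as a formal power series. -/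
def monomialIn {p : ℕ} (α : Fin p → MvPolynomial ι ℝ) (k : Fin p → ℕ) : MvPowerSeries ι ℝ :=
  ((∏ i, α i ^ k i : MvPolynomial ι ℝ) : MvPowerSeries ι ℝ)

/-- `α = (α₁, …, α_p)` is a Hilbert basis for the invariants `ker 𝒳`, `𝒳 = 𝒟_{N*}`: each `α_i` is a
homogeneous polynomial, lies in `ker 𝒳` and is an eigenvector of `𝒵 = 𝒟_H`, and each polynomial
invariant is a polynomial in `α₁, …, α_p`. -/
structure IsHilbertBasis [DecidableEq ι] (N H : Matrix ι ι ℝ) {p : ℕ}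
    (α : Fin p → MvPolynomial ι ℝ) : Prop where
  homogeneous : ∀ i, ∃ e : ℕ, (α i).IsHomogeneous e
  invariant : ∀ i, opD N.transpose (α i : MvPowerSeries ι ℝ) = 0
  weightVector : ∀ i, ∃ μ : ℝ, (opD H).HasEigenvector μ (α i : MvPowerSeries ι ℝ)
  generates : ∀ f : MvPolynomial ι ℝ, opD N.transpose (f : MvPowerSeries ι ℝ) = 0 →
    ∃ P : MvPolynomial (Fin p) ℝ, MvPolynomial.aeval α P = f

/-- `A` is a set of (exponents of) preferred monomials in `α`: the monomials `α^k`, `k ∈ A`, form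
a formal vector space basis of the formal invariants `𝒥 = ker 𝒳`, `𝒳 = 𝒟_{N*}`. -/
def IsPreferred [DecidableEq ι] (N : Matrix ι ι ℝ) {p : ℕ} (α : Fin p → MvPolynomial ι ℝ)
    (A : Set (Fin p → ℕ)) : Prop :=
  IsFormalBasis scalarCoeff (fun k : A => monomialIn α k) (LinearMap.ker (opD N.transpose))

/-- The index set of the pre-box product: triples `(k, j, s)` with `k ∈ A`, `s` at most the weight
of `α^k` and `s` at most the weight of `b_j`. -/
def Admissible [DecidableEq ι] (H : Matrix ι ι ℝ) {p q : ℕ} (α : Fin p → MvPolynomial ι ℝ)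
    (A : Set (Fin p → ℕ)) (b : Fin q → ι → ℝ) : Set ((Fin p → ℕ) × Fin q × ℕ) :=
  {t | t.1 ∈ A ∧ t.2.2 ≤ weight (opD H) (monomialIn α t.1) ∧
    t.2.2 ≤ weight (Matrix.toLin' (-H)) (b t.2.1)}

/-- The pre-box product of `A` and `b`: the admissible transvectants `(α^k, b_j)^{(s)}`. -/
def preBox [DecidableEq ι] (M H : Matrix ι ι ℝ) {p q : ℕ} (α : Fin p → MvPolynomial ι ℝ)
    (A : Set (Fin p → ℕ)) (b : Fin q → ι → ℝ) (t : Admissible H α A b) : FormalVF ι :=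
  transvectant M H (monomialIn α t.1.1) (b t.1.2.1) t.1.2.2

end General

end Boosting

end

noncomputable section

namespace Boosting

/-! ### Calculus of formal (possibly infinite) linear combinations. -/

section FormalComb

variable {K K' I J V V' : Type*} [AddCommGroup V] [Module ℝ V] [AddCommGroup V'] [Module ℝ V']
  {coef : K → V →ₗ[ℝ] ℝ} {coef' : K' → V' →ₗ[ℝ] ℝ}

/-! The matrix `N*` shifts rows inside a block, so the equation `L_{N*} v = 0` says that `𝒳` carries
each component to the one in the row above and kills the top one. An equivariant is therefore
determined by its bottom components, and the one in block `j` lies in `ker 𝒳 ^ d j`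
(`equivariant_apply`, `equivariant_pow_apply_eq_zero`). Admissible transvectants are equivariants
(`lieOp_transvectant`), and the bottom components of `(α^k, b_j)^{(s)}` vanish except in block `j`,
where only the last term survives: a nonzero multiple of `𝒴^s α^k` (`transvectant_bottomIdx`). Since
`b_j` has weight `d j - 1`, the theorem reduces to this: the vectors `𝒴^s α^k` with `s < w` and `s`
at most the weight of `α^k` expand every element of `ker 𝒳 ^ w` uniquely.

That statement is proved by induction on `w` (`exists_expansion`, `expansion_unique`). If `𝒳^(w+1) x
= 0`, then `𝒳^w x` is an invariant, hence a formal combination of the `α^k`; as `𝒳^w 𝒴^w α^k` is a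
nonzero multiple of `α^k` when the weight is at least `w`, a combination of the `𝒴^w α^k` can be
subtracted from `x`. The obstacle is that weights below `w` must not occur in `𝒳^w x`. This is where
positivity enters (`coeff_eq_zero_of_weight_lt`): a weighted Fischer form makes `𝒳` and `𝒴` adjoint,
so the image of `𝒳^w` is orthogonal to the kernel of `𝒴^w`. Such a form is available because the
triad must be the standard one (`IsTriad.eq_standard`). -/

theorem finsum_comp_of_injective {e : I → J} (he : Function.Injective e) {F : J → ℝ}
    (hF : ∀ j ∉ Set.range e, F j = 0) : ∑ᶠ i, F (e i) = ∑ᶠ j, F j := by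
  rw [← finsum_mem_range he, finsum_mem_def]
  refine finsum_congr fun j => ?_
  by_cases hj : j ∈ Set.range e
  · rw [Set.indicator_of_mem hj]
  · rw [Set.indicator_of_notMem hj, hF j hj]

theorem finite_support_comp_iff {e : I → J} (he : Function.Injective e) {F : J → ℝ}
    (hF : ∀ j ∉ Set.range e, F j = 0) :
    (Function.support fun i => F (e i)).Finite ↔ (Function.support F).Finite := by
  have h : Function.support F = e '' Function.support fun i => F (e i) := by
    ext j
    constructor
    · intro hj
      by_cases hr : j ∈ Set.range e
      · obtain ⟨i, rfl⟩ := hr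
        exact ⟨i, hj, rfl⟩
      · exact absurd (hF j hr) hj
    · rintro ⟨i, hi, rfl⟩
      exact hi
  rw [h, Set.finite_image_iff he.injOn]

/-- A functional that is a finite combination of coefficient functionals commutes with formal
linear combinations. -/
theorem IsFormalComb.apply {v : I → V} {c : I → ℝ} {x : V} (h : IsFormalComb coef v c x)
    {φ : V →ₗ[ℝ] ℝ} (hφ : φ ∈ Submodule.span ℝ (Set.range coef)) :
    (Function.support fun i => c i * φ (v i)).Finite ∧ φ x = ∑ᶠ i, c i * φ (v i) := by
  induction hφ using Submodule.span_induction with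
  | mem φ hφ =>
    obtain ⟨m, rfl⟩ := hφ
    exact h m
  | zero => simp
  | add φ ψ _ _ hφ hψ =>
    have e : (fun i => c i * (φ + ψ) (v i)) = (fun i => c i * φ (v i)) + fun i => c i * ψ (v i) := by
      funext i
      simp [mul_add]
    refine ⟨?_, ?_⟩
    · rw [e]
      exact (hφ.1.union hψ.1).subset (Function.support_add _ _)
    · rw [LinearMap.add_apply, hφ.2, hψ.2, ← finsum_add_distrib hφ.1 hψ.1]
      exact finsum_congr fun i => (congrFun e i).symm
  | smul r φ _ hφ =>
    have e : (fun i => c i * (r • φ) (v i)) = fun i => r * (c i * φ (v i)) := by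
      funext i
      simp only [LinearMap.smul_apply, smul_eq_mul]
      ring
    refine ⟨?_, ?_⟩
    · rw [e]
      exact hφ.1.subset fun i hi => right_ne_zero_of_mul hi
    · rw [e, LinearMap.smul_apply, hφ.2, smul_eq_mul, mul_finsum' _ _ hφ.1]

/-- The finitary hypothesis plays the role of continuity: it lets `T` pass through infinite sums. -/
theorem IsFormalComb.map {v : I → V} {c : I → ℝ} {x : V} (h : IsFormalComb coef v c x)
    {T : V →ₗ[ℝ] V'} (hT : ∀ m, coef' m ∘ₗ T ∈ Submodule.span ℝ (Set.range coef)) :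
    IsFormalComb coef' (fun i => T (v i)) c (T x) :=
  fun m => h.apply (hT m)

theorem IsFormalComb.congr {v v' : I → V} {c c' : I → ℝ} {x : V} (h : IsFormalComb coef v c x)
    (e : ∀ i, c i • v i = c' i • v' i) : IsFormalComb coef v' c' x := by
  intro m
  have : (fun i => c' i * coef m (v' i)) = fun i => c i * coef m (v i) := by
    funext i
    simpa using (congrArg (coef m) (e i)).symm
  rw [this]
  exact h m

theorem isFormalComb_comp_iff {v : J → V} {c : J → ℝ} {x : V} {e : I → J}
    (he : Function.Injective e) (hc : ∀ j ∉ Set.range e, c j • v j = 0) :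
    IsFormalComb coef (fun i => v (e i)) (fun i => c (e i)) x ↔ IsFormalComb coef v c x := by
  refine forall_congr' fun m => ?_
  have hF : ∀ j ∉ Set.range e, c j * coef m (v j) = 0 := fun j hj => by
    simpa using congrArg (coef m) (hc j hj)
  rw [← finsum_comp_of_injective he hF, ← finite_support_comp_iff he hF]

theorem IsFormalComb.add {v : I → V} {c c' : I → ℝ} {x x' : V} (h : IsFormalComb coef v c x)
    (h' : IsFormalComb coef v c' x') : IsFormalComb coef v (c + c') (x + x') := by
  intro m
  have e : (fun i => (c + c') i * coef m (v i)) =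
      (fun i => c i * coef m (v i)) + fun i => c' i * coef m (v i) := by
    funext i
    simp [add_mul]
  refine ⟨?_, ?_⟩
  · rw [e]
    exact ((h m).1.union (h' m).1).subset (Function.support_add _ _)
  · rw [map_add, (h m).2, (h' m).2, ← finsum_add_distrib (h m).1 (h' m).1]
    exact finsum_congr fun i => (congrFun e i).symm

theorem IsFormalComb.neg {v : I → V} {c : I → ℝ} {x : V} (h : IsFormalComb coef v c x) :
    IsFormalComb coef v (-c) (-x) := by
  intro m
  have e : (fun i => (-c) i * coef m (v i)) = -fun i => c i * coef m (v i) := by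
    funext i
    simp
  refine ⟨?_, ?_⟩
  · rw [e, Function.support_neg]
    exact (h m).1
  · rw [map_neg, (h m).2, ← finsum_neg_distrib]
    exact finsum_congr fun i => (congrFun e i).symm

theorem IsFormalComb.sub {v : I → V} {c c' : I → ℝ} {x x' : V} (h : IsFormalComb coef v c x)
    (h' : IsFormalComb coef v c' x') : IsFormalComb coef v (c - c') (x - x') := by
  rw [sub_eq_add_neg, sub_eq_add_neg]
  exact h.add h'.neg

theorem isFormalComb_zero (v : I → V) : IsFormalComb coef v 0 0 := by
  intro m
  simp

theorem IsFormalComb.eq_zero {v : I → V} {c : I → ℝ} {x : V} (h : IsFormalComb coef v c x)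
    (hsep : ∀ x, (∀ m, coef m x = 0) → x = 0) (h0 : ∀ i, c i • v i = 0) : x = 0 := by
  have h' := h.congr (c' := 0) (v' := v) fun i => by simpa using h0 i
  exact hsep x fun m => by simpa using (h' m).2

/-- Formal combinations with restricted support exist when all prescribed coefficients occur. -/
theorem IsFormalComb.exists_of_support {v : I → V} {c : I → ℝ} {x : V}
    (h : IsFormalComb coef v c x) (hfull : ∀ g : K → ℝ, ∃ y, ∀ m, coef m y = g m) {c' : I → ℝ}
    (hc : ∀ i, c i = 0 → c' i = 0) : ∃ y, IsFormalComb coef v c' y := by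
  obtain ⟨y, hy⟩ := hfull fun m => ∑ᶠ i, c' i * coef m (v i)
  refine ⟨y, fun m => ⟨(h m).1.subset fun i hi => ?_, hy m⟩⟩
  simp only [Function.mem_support, ne_eq, mul_eq_zero, not_or] at hi ⊢
  exact ⟨fun h => hi.1 (hc i h), hi.2⟩

theorem isFormalComb_of_finsupp (v : I → V) (c : I →₀ ℝ) :
    IsFormalComb coef v c (Finsupp.linearCombination ℝ v c) := by
  intro m
  have hs : (Function.support fun i => c i * coef m (v i)) ⊆ c.support := fun i hi => by
    simp only [Function.mem_support, ne_eq, mul_eq_zero, not_or] at hi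
    simpa using hi.1
  refine ⟨c.support.finite_toSet.subset hs, ?_⟩
  rw [finsum_eq_sum_of_support_subset _ hs, Finsupp.linearCombination_apply, Finsupp.sum, map_sum]
  simp

/-- A finite linear relation is a formal expansion of `0`, so uniqueness of that expansion already
contains linear independence. -/
theorem IsFormalBasis.of_existsUnique {v : I → V} {E : Submodule ℝ V} (hv : ∀ i, v i ∈ E)
    (h : ∀ x ∈ E, ∃! c : I → ℝ, IsFormalComb coef v c x) : IsFormalBasis coef v E where
  mem := hv
  existsUnique_comb := h
  linearIndependent := by
    rw [linearIndependent_iff]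
    intro c hc
    have h1 := isFormalComb_of_finsupp (coef := coef) v c
    rw [hc] at h1
    have := (h 0 E.zero_mem).unique h1 (isFormalComb_zero v)
    exact DFunLike.coe_injective this

end FormalComb

/-! ### Raising and lowering a top weight vector. -/

section Ladder

variable {V : Type*} [AddCommGroup V] [Module ℝ V] {X Y Z : Module.End ℝ V}

theorem weight_lowering (hZY : Z * Y - Y * Z = (-2 : ℝ) • Y) {f : V} {a : ℝ} (hf : Z f = a • f)
    (j : ℕ) : Z ((Y ^ j) f) = (a - 2 * j) • (Y ^ j) f := by
  induction j with
  | zero => simpa using hf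
  | succ j ih =>
    have h := LinearMap.congr_fun hZY ((Y ^ j) f)
    simp only [LinearMap.sub_apply, Module.End.mul_apply, LinearMap.smul_apply] at h
    rw [pow_succ', Module.End.mul_apply, eq_add_of_sub_eq h, ih, map_smul, ← add_smul]
    congr 1
    push_cast
    ring

/-- Commuting `X` past the lowering operators collects the weights `a, a - 2, …, a - 2j`, whose sum
is `(j + 1)(a - j)`. -/
theorem raise_lowering (hXY : X * Y - Y * X = Z) (hZY : Z * Y - Y * Z = (-2 : ℝ) • Y) {f : V}
    {a : ℝ} (hX : X f = 0) (hf : Z f = a • f) (j : ℕ) :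
    X ((Y ^ (j + 1)) f) = ((j + 1) * (a - j)) • (Y ^ j) f := by
  induction j with
  | zero =>
    have h := LinearMap.congr_fun hXY f
    simp only [LinearMap.sub_apply, Module.End.mul_apply, hX, map_zero, sub_zero] at h
    simp [h, hf]
  | succ j ih =>
    have h := LinearMap.congr_fun hXY ((Y ^ (j + 1)) f)
    simp only [LinearMap.sub_apply, Module.End.mul_apply] at h
    rw [pow_succ', Module.End.mul_apply, eq_add_of_sub_eq h, weight_lowering hZY hf, ih, map_smul,
      ← Module.End.mul_apply, ← pow_succ', ← add_smul]
    congr 1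
    push_cast
    ring

/-- The scalar is a product of factors `(i + 1)(a - i)` with `i < w ≤ a`, none of which vanishes. -/
theorem raise_pow_lowering_pow (hXY : X * Y - Y * X = Z) (hZY : Z * Y - Y * Z = (-2 : ℝ) • Y)
    {f : V} {a : ℕ} (hX : X f = 0) (hf : Z f = (a : ℝ) • f) (w : ℕ) (hw : w ≤ a) :
    ∃ κ : ℝ, κ ≠ 0 ∧ (X ^ w) ((Y ^ w) f) = κ • f := by
  induction w with
  | zero => exact ⟨1, one_ne_zero, by simp⟩
  | succ w ih =>
    obtain ⟨κ, hκ, h⟩ := ih (by omega)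
    refine ⟨((w + 1) * (a - w)) * κ, ?_, ?_⟩
    · have : (w : ℝ) < a := by exact_mod_cast hw
      have : (a : ℝ) - w ≠ 0 := by linarith
      positivity
    · rw [pow_succ, Module.End.mul_apply, raise_lowering hXY hZY hX hf, map_smul, h, smul_smul]

theorem raise_pow_lowering_pow_eq_zero (hXY : X * Y - Y * X = Z)
    (hZY : Z * Y - Y * Z = (-2 : ℝ) • Y) {f : V} {a : ℝ} (hX : X f = 0) (hf : Z f = a • f) (s : ℕ) :
    ∀ w, s < w → (X ^ w) ((Y ^ s) f) = 0 := by
  induction s with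
  | zero =>
    intro w hw
    obtain ⟨w, rfl⟩ : ∃ k, w = k + 1 := ⟨w - 1, by omega⟩
    simp [pow_succ, hX]
  | succ s ih =>
    intro w hw
    obtain ⟨w, rfl⟩ : ∃ k, w = k + 1 := ⟨w - 1, by omega⟩
    rw [pow_succ, Module.End.mul_apply, raise_lowering hXY hZY hX hf, map_smul, ih w (by omega),
      smul_zero]

end Ladder

/-! ### Unitarizable representations and expansions in lowered top weight vectors. -/

/-- A representation of `sl₂` on a space with coefficient functionals, with a separating family of
positive semidefinite forms for which raising and lowering are adjoint. -/
structure IsUnitarizable {K V : Type*} [AddCommGroup V] [Module ℝ V] (coef : K → V →ₗ[ℝ] ℝ)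
    (X Y Z : Module.End ℝ V) (B : ℕ → V →ₗ[ℝ] V →ₗ[ℝ] ℝ) : Prop where
  comm_XY : X * Y - Y * X = Z
  comm_ZY : Z * Y - Y * Z = (-2 : ℝ) • Y
  separating : ∀ x, (∀ m, coef m x = 0) → x = 0
  full : ∀ g : K → ℝ, ∃ y, ∀ m, coef m y = g m
  finitary_X : ∀ m, coef m ∘ₗ X ∈ Submodule.span ℝ (Set.range coef)
  finitary_Y : ∀ m, coef m ∘ₗ Y ∈ Submodule.span ℝ (Set.range coef)
  finitary_form : ∀ g u, B g u ∈ Submodule.span ℝ (Set.range coef)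
  form_symm : ∀ g u v, B g u v = B g v u
  form_nonneg : ∀ g u, 0 ≤ B g u u
  form_definite : ∀ u, (∀ g, B g u u = 0) → u = 0
  form_adjoint : ∀ g u v, B g (X u) v = B g u (Y v)

theorem comp_mem_span_range {K V : Type*} [AddCommGroup V] [Module ℝ V] {coef : K → V →ₗ[ℝ] ℝ}
    {T : Module.End ℝ V} (hT : ∀ m, coef m ∘ₗ T ∈ Submodule.span ℝ (Set.range coef))
    {φ : V →ₗ[ℝ] ℝ} (hφ : φ ∈ Submodule.span ℝ (Set.range coef)) :
    φ ∘ₗ T ∈ Submodule.span ℝ (Set.range coef) := by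
  induction hφ using Submodule.span_induction with
  | mem φ hφ =>
    obtain ⟨m, rfl⟩ := hφ
    exact hT m
  | zero => simp
  | add φ ψ _ _ hφ hψ =>
    rw [LinearMap.add_comp]
    exact add_mem hφ hψ
  | smul r φ _ hφ =>
    rw [LinearMap.smul_comp]
    exact Submodule.smul_mem _ r hφ

theorem pow_comp_mem_span_range {K V : Type*} [AddCommGroup V] [Module ℝ V]
    {coef : K → V →ₗ[ℝ] ℝ} {T : Module.End ℝ V}
    (hT : ∀ m, coef m ∘ₗ T ∈ Submodule.span ℝ (Set.range coef)) (w : ℕ) (m : K) :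
    coef m ∘ₗ (T ^ w) ∈ Submodule.span ℝ (Set.range coef) := by
  induction w with
  | zero => exact Submodule.subset_span ⟨m, rfl⟩
  | succ w ih =>
    have := comp_mem_span_range hT ih
    rwa [LinearMap.comp_assoc, ← Module.End.mul_eq_comp, ← pow_succ] at this

namespace IsUnitarizable

variable {K V : Type*} [AddCommGroup V] [Module ℝ V] {coef : K → V →ₗ[ℝ] ℝ}
  {X Y Z : Module.End ℝ V} {B : ℕ → V →ₗ[ℝ] V →ₗ[ℝ] ℝ}

theorem form_adjoint' (U : IsUnitarizable coef X Y Z B) (g : ℕ) (u v : V) :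
    B g (Y u) v = B g u (X v) := by
  rw [U.form_symm, ← U.form_adjoint, U.form_symm]

theorem form_adjoint_pow (U : IsUnitarizable coef X Y Z B) (g s : ℕ) (u v : V) :
    B g ((Y ^ s) u) v = B g u ((X ^ s) v) := by
  induction s generalizing u with
  | zero => rfl
  | succ s ih => rw [pow_succ, Module.End.mul_apply, ih, U.form_adjoint', pow_succ',
      Module.End.mul_apply]

theorem form_selfAdjoint (U : IsUnitarizable coef X Y Z B) (g : ℕ) (u v : V) :
    B g (Z u) v = B g u (Z v) := by
  simp only [← U.comm_XY, LinearMap.sub_apply, Module.End.mul_apply, map_sub, U.form_adjoint,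
    U.form_adjoint']

theorem form_eq_zero_of_weight_ne (U : IsUnitarizable coef X Y Z B) {f h : V} {a b : ℝ}
    (hf : Z f = a • f) (hh : Z h = b • h) (hab : a ≠ b) (g : ℕ) : B g f h = 0 := by
  have := U.form_selfAdjoint g f h
  rw [hf, hh] at this
  simp only [map_smul, LinearMap.smul_apply, smul_eq_mul] at this
  have h' : (a - b) * B g f h = 0 := by linarith
  exact (mul_eq_zero.1 h').resolve_left (sub_ne_zero.2 hab)

theorem form_lowering_succ (U : IsUnitarizable coef X Y Z B) {f : V} {a : ℝ} (hX : X f = 0)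
    (hf : Z f = a • f) (g j : ℕ) :
    B g ((Y ^ (j + 1)) f) ((Y ^ (j + 1)) f) =
      ((j + 1) * (a - j)) * B g ((Y ^ j) f) ((Y ^ j) f) := by
  conv_lhs => rw [pow_succ', Module.End.mul_apply, U.form_adjoint', ← Module.End.mul_apply Y,
    ← pow_succ', raise_lowering U.comm_XY U.comm_ZY hX hf]
  rw [map_smul, smul_eq_mul]

/-- The weight of a nonzero top weight vector is a natural number. -/
theorem exists_nat_weight (U : IsUnitarizable coef X Y Z B) {f : V} {a : ℝ} (h0 : f ≠ 0)
    (hX : X f = 0) (hf : Z f = a • f) : ∃ n : ℕ, a = n := by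
  by_contra! hn
  obtain ⟨g, hg⟩ : ∃ g, B g f f ≠ 0 := by
    by_contra! h
    exact h0 (U.form_definite f h)
  -- The squared norms are multiplied by `(j + 1)(a - j)` at each step. If `a` is not natural they
  -- never reach zero, so nonnegativity forces `a > j` for every `j`.
  have key : ∀ j : ℕ, 0 < B g ((Y ^ j) f) ((Y ^ j) f) ∧ (j : ℝ) ≤ a + 1 := by
    intro j
    induction j with
    | zero =>
      refine ⟨lt_of_le_of_ne (U.form_nonneg g f) hg.symm, ?_⟩
      have h1 := U.form_nonneg g ((Y ^ 1) f)
      have h2 := U.form_lowering_succ hX hf g 0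
      have h3 := lt_of_le_of_ne (U.form_nonneg g f) hg.symm
      rw [zero_add] at h2
      rw [h2] at h1
      simp only [Nat.cast_zero, zero_add, one_mul, sub_zero, pow_zero, Module.End.one_apply] at h1 ⊢
      linarith [nonneg_of_mul_nonneg_left h1 h3]
    | succ j ih =>
      have h1 := U.form_nonneg g ((Y ^ (j + 1)) f)
      have h2 := U.form_lowering_succ hX hf g j
      rw [h2] at h1 ⊢
      have h3 := nonneg_of_mul_nonneg_left h1 ih.1
      have h4 : 0 ≤ a - j := nonneg_of_mul_nonneg_right h3 (by positivity)
      have h5 : 0 < a - j := lt_of_le_of_ne h4 (sub_ne_zero.2 (hn j)).symm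
      refine ⟨mul_pos (mul_pos (by positivity) h5) ih.1, ?_⟩
      push_cast
      linarith
  obtain ⟨j, hj⟩ := exists_nat_gt (a + 1)
  exact absurd (key j).2 (not_le.2 hj)

/-- The squared norm of `Y ^ (a + 1)` applied to `f` contains the factor `a - a`, and the forms are
jointly definite. -/
theorem lowering_eq_zero (U : IsUnitarizable coef X Y Z B) {f : V} {a : ℕ} (hX : X f = 0)
    (hf : Z f = (a : ℝ) • f) {s : ℕ} (hs : a < s) : (Y ^ s) f = 0 := by
  have h : (Y ^ (a + 1)) f = 0 := U.form_definite _ fun g => by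
    rw [U.form_lowering_succ hX hf, sub_self, mul_zero, zero_mul]
  obtain ⟨r, rfl⟩ := Nat.exists_eq_add_of_le hs
  rw [Nat.succ_eq_add_one, add_comm, pow_add, Module.End.mul_apply, h, map_zero]

variable {I : Type*} {f : I → V} {a : I → ℕ}

/-- A top weight vector in the image of `X ^ w` involves only weights that are at least `w`. -/
theorem coeff_eq_zero_of_weight_lt (U : IsUnitarizable coef X Y Z B) (hX : ∀ k, X (f k) = 0)
    (hZ : ∀ k, Z (f k) = (a k : ℝ) • f k)
    (hJ : ∀ x, X x = 0 → ∃! c : I → ℝ, IsFormalComb coef f c x) {w : ℕ} {x : V} {c : I → ℝ}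
    (hc : IsFormalComb coef f c ((X ^ w) x)) {k : I} (hk : a k < w) : c k = 0 := by
  set c' : I → ℝ := fun k => if a k < w then c k else 0 with hc'
  -- `u` is the part of `X ^ w x` of weights below `w`. It is killed by `Y ^ w`, hence orthogonal to
  -- `X ^ w x`; it is also orthogonal to the remaining part, whose weights differ. So `u` is
  -- orthogonal to itself.
  obtain ⟨u, hu⟩ := hc.exists_of_support U.full (c' := c') fun i hi => by simp [hc', hi]
  have hYu : (Y ^ w) u = 0 := by
    refine (hu.map (pow_comp_mem_span_range U.finitary_Y w)).eq_zero U.separating fun i => ?_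
    by_cases hi : a i < w
    · rw [U.lowering_eq_zero (hX i) (hZ i) hi, smul_zero]
    · simp [hc', hi]
  have horth : ∀ g l, ¬ a l < w → B g u (f l) = 0 := by
    intro g l hl
    rw [U.form_symm, (hu.apply (U.finitary_form g (f l))).2]
    refine (finsum_congr fun i => ?_).trans finsum_zero
    by_cases hi : a i < w
    · rw [U.form_eq_zero_of_weight_ne (hZ l) (hZ i), mul_zero]
      intro h
      exact hl (Nat.cast_injective (R := ℝ) h ▸ hi)
    · simp [hc', hi]
  have hu0 : u = 0 := by
    refine U.form_definite u fun g => ?_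
    have h1 : B g u ((X ^ w) x) = 0 := by
      rw [← U.form_adjoint_pow, hYu, map_zero, LinearMap.zero_apply]
    have h2 : B g u ((X ^ w) x - u) = 0 := by
      rw [((hc.sub hu).apply (U.finitary_form g u)).2]
      refine (finsum_congr fun i => ?_).trans finsum_zero
      by_cases hi : a i < w
      · simp [hc', hi]
      · rw [horth g i hi, mul_zero]
    rw [map_sub, h1] at h2
    linarith
  rw [hu0] at hu
  have := congrFun ((hJ 0 (map_zero X)).unique hu (isFormalComb_zero f)) k
  simpa [hc', hk] using this

/-- Each vector killed by a power of `X` is a formal combination of lowered top weight vectors. -/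
theorem exists_expansion (U : IsUnitarizable coef X Y Z B) (hX : ∀ k, X (f k) = 0)
    (hZ : ∀ k, Z (f k) = (a k : ℝ) • f k)
    (hJ : ∀ x, X x = 0 → ∃! c : I → ℝ, IsFormalComb coef f c x) (w : ℕ) (x : V)
    (hx : (X ^ w) x = 0) :
    ∃ c : I × ℕ → ℝ, (∀ t, c t ≠ 0 → t.2 ≤ a t.1 ∧ t.2 < w) ∧
      IsFormalComb coef (fun t : I × ℕ => (Y ^ t.2) (f t.1)) c x := by
  classical
  induction w generalizing x with
  | zero =>
    have hx' : x = 0 := hx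
    subst hx'
    exact ⟨0, fun t ht => absurd rfl ht, isFormalComb_zero _⟩
  | succ w ih =>
    rw [pow_succ', Module.End.mul_apply] at hx
    obtain ⟨c, hc, -⟩ := hJ _ hx
    have hlt : ∀ k, a k < w → c k = 0 := fun k hk =>
      U.coeff_eq_zero_of_weight_lt hX hZ hJ hc hk
    -- The clause `c k = 0 → b = 0` keeps the support inside that of `c`, which makes the formal sum
    -- of the `b k • f k` exist.
    have hκ : ∀ k, ∃ b : ℝ, (c k = 0 → b = 0) ∧ b • (X ^ w) ((Y ^ w) (f k)) = c k • f k := by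
      intro k
      by_cases hk : a k < w
      · exact ⟨0, fun _ => rfl, by simp [hlt k hk]⟩
      · obtain ⟨κ, hκ, h⟩ :=
          raise_pow_lowering_pow U.comm_XY U.comm_ZY (hX k) (hZ k) w (not_lt.1 hk)
        exact ⟨c k / κ, fun h => by simp [h], by rw [h, smul_smul, div_mul_cancel₀ _ hκ]⟩
    choose b hb0 hb using hκ
    obtain ⟨y, hy⟩ := hc.exists_of_support U.full hb0
    have hYy := hy.map (pow_comp_mem_span_range U.finitary_Y w)
    have hXy := (hYy.map (pow_comp_mem_span_range U.finitary_X w)).congr hb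
    have hxy : (X ^ w) (x - (Y ^ w) y) = 0 := by
      rw [map_sub]
      exact (hc.sub hXy).eq_zero U.separating fun i => by simp
    obtain ⟨c₁, hc₁, hx₁⟩ := ih _ hxy
    set c₂ : I × ℕ → ℝ := fun t => if t.2 = w then b t.1 else 0 with hc₂
    have he : Function.Injective fun k : I => (k, w) := fun k l h => congrArg Prod.fst h
    have hx₂ : IsFormalComb coef (fun t : I × ℕ => (Y ^ t.2) (f t.1)) c₂ ((Y ^ w) y) := by
      rw [← isFormalComb_comp_iff he]
      · simpa [hc₂] using hYy
      · rintro ⟨k, s⟩ hk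
        have : s ≠ w := fun h => hk ⟨k, by simp [h]⟩
        simp [hc₂, this]
    refine ⟨c₁ + c₂, fun t ht => ?_, by simpa using hx₁.add hx₂⟩
    by_cases h1 : c₁ t = 0
    · have h2 : c₂ t ≠ 0 := by simpa [h1] using ht
      by_cases hw : t.2 = w
      · refine ⟨?_, by omega⟩
        by_contra hlt'
        refine h2 ?_
        simp only [hc₂, hw, if_true]
        exact hb0 _ (hlt _ (by omega))
      · exact absurd (by simp [hc₂, hw]) h2
    · have := hc₁ t h1
      exact ⟨this.1, by omega⟩

/-- Applying `X ^ w` with `w` the highest allowed lowering power kills the lower terms and returns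
nonzero multiples of the `f k`, so the coefficients at `w` vanish. The bound `t.2 ≤ a t.1` is
essential: beyond it the lowered vectors are zero and their coefficients would be arbitrary. -/
theorem expansion_unique (U : IsUnitarizable coef X Y Z B) (hX : ∀ k, X (f k) = 0)
    (hZ : ∀ k, Z (f k) = (a k : ℝ) • f k)
    (hJ : ∀ x, X x = 0 → ∃! c : I → ℝ, IsFormalComb coef f c x) (w : ℕ) (c : I × ℕ → ℝ)
    (hc : ∀ t, c t ≠ 0 → t.2 ≤ a t.1 ∧ t.2 < w)
    (h : IsFormalComb coef (fun t : I × ℕ => (Y ^ t.2) (f t.1)) c 0) : c = 0 := by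
  induction w with
  | zero =>
    funext t
    by_contra ht
    exact absurd (hc t ht).2 (by omega)
  | succ w ih =>
    refine ih fun t ht => ⟨(hc t ht).1, lt_of_le_of_ne (Nat.lt_succ_iff.1 (hc t ht).2) ?_⟩
    rintro rfl
    obtain ⟨k, w⟩ := t
    simp only at hc ih ht
    have he : Function.Injective fun k : I => (k, w) := fun k l h => congrArg Prod.fst h
    have h1 := h.map (pow_comp_mem_span_range U.finitary_X w)
    rw [map_zero, ← isFormalComb_comp_iff he] at h1
    · have hκ : ∀ l, ∃ κ : ℝ, (κ = 0 → c (l, w) = 0) ∧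
          c (l, w) • (X ^ w) ((Y ^ w) (f l)) = (c (l, w) * κ) • f l := by
        intro l
        by_cases hl : c (l, w) = 0
        · exact ⟨0, fun _ => hl, by simp [hl]⟩
        · obtain ⟨κ, hκ, h⟩ :=
            raise_pow_lowering_pow U.comm_XY U.comm_ZY (hX l) (hZ l) w (hc _ hl).1
          exact ⟨κ, fun h => absurd h hκ, by rw [h, smul_smul]⟩
      choose κ hκ0 hκ using hκ
      have h2 := congrFun ((hJ 0 (map_zero X)).unique (h1.congr hκ) (isFormalComb_zero f)) k
      rcases mul_eq_zero.1 h2 with h2 | h2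
      · exact ht h2
      · exact ht (hκ0 k h2)
    · rintro ⟨l, s⟩ hl
      by_cases h0 : c (l, s) = 0
      · rw [h0, zero_smul]
      · have hs : s ≠ w := fun h => hl ⟨l, by simp [h]⟩
        have := (hc _ h0).2
        simp only at this
        rw [raise_pow_lowering_pow_eq_zero U.comm_XY U.comm_ZY (hX l) (hZ l) s w (by omega),
          smul_zero]

end IsUnitarizable

/-! ### Directional derivatives and the weighted Fischer form. -/

section PowerSeries

open MvPowerSeries

theorem pderiv_comm {σ : Type*} (i k : σ) (f : MvPowerSeries σ ℝ) :
    pderiv ℝ i (pderiv ℝ k f) = pderiv ℝ k (pderiv ℝ i f) := by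
  ext n
  simp only [coeff_pderiv]
  rw [add_right_comm]
  by_cases h : i = k
  · rw [h]
  · simp [h, Ne.symm h]
    ring

variable {ι : Type*} [Fintype ι]

/-- The weight of the monomial `m` in the Fischer form with weights `c` on the variables. -/
def fischerWeight (c : ι → ℝ) (m : ι →₀ ℕ) : ℝ := ∏ i, c i ^ m i * ((m i).factorial : ℝ)

theorem fischerWeight_pos {c : ι → ℝ} (hc : ∀ i, 0 < c i) (m : ι →₀ ℕ) : 0 < fischerWeight c m :=
  Finset.prod_pos fun i _ => mul_pos (pow_pos (hc i) _) (by positivity)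

variable [DecidableEq ι]

theorem dirDeriv_apply (A : Matrix ι ι ℝ) (f : MvPowerSeries ι ℝ) :
    dirDeriv A f = ∑ i, ∑ j, A i j • (X j * pderiv ℝ i f) := by
  have h : dirDeriv A f =
      ∑ i, ((∑ j, A i j • (X j : MvPowerSeries ι ℝ)) • pderiv ℝ i : Derivation ℝ _ _) f :=
    map_sum ((Pi.evalAddMonoidHom _ f).comp Derivation.coeFnAddMonoidHom) _ _
  rw [h]
  refine Finset.sum_congr rfl fun i _ => ?_
  rw [Derivation.smul_apply, smul_eq_mul, Finset.sum_mul]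
  simp only [smul_mul_assoc]

theorem dirDeriv_X (A : Matrix ι ι ℝ) (k : ι) :
    dirDeriv A (X k : MvPowerSeries ι ℝ) = ∑ j, A k j • (X j : MvPowerSeries ι ℝ) := by
  rw [dirDeriv_apply, Finset.sum_eq_single k]
  · simp
  · intro i _ hi
    simp [pderiv_X_of_ne hi.symm]
  · simp

/-- The second-order part is symmetric in `A` and `B` because partial derivatives commute, so a
commutator retains only the first-order part. The order of the product is reversed, which the
transposes in `𝒳` and `𝒴` compensate. -/
theorem dirDeriv_dirDeriv (A B : Matrix ι ι ℝ) (f : MvPowerSeries ι ℝ) :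
    dirDeriv A (dirDeriv B f) = dirDeriv (B * A) f +
      ∑ k, ∑ j, ∑ i, ∑ l, (B k j * A i l) • (X j * X l * pderiv ℝ i (pderiv ℝ k f)) := by
  rw [dirDeriv_apply B, map_sum]
  simp only [map_sum, Derivation.map_smul, Derivation.leibniz, smul_eq_mul, dirDeriv_X]
  simp only [smul_add, Finset.sum_add_distrib]
  rw [add_comm]
  congr 1
  · rw [dirDeriv_apply]
    refine Finset.sum_congr rfl fun k _ => ?_
    simp only [Finset.mul_sum, Finset.smul_sum, Matrix.mul_apply, Finset.sum_smul]
    rw [Finset.sum_comm]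
    refine Finset.sum_congr rfl fun l _ => Finset.sum_congr rfl fun j _ => ?_
    rw [mul_smul_comm, smul_smul, mul_comm (pderiv ℝ k f)]
  · refine Finset.sum_congr rfl fun k _ => Finset.sum_congr rfl fun j _ => ?_
    rw [dirDeriv_apply]
    simp only [Finset.mul_sum, Finset.smul_sum]
    refine Finset.sum_congr rfl fun i _ => Finset.sum_congr rfl fun l _ => ?_
    rw [mul_smul_comm, smul_smul, mul_assoc]

theorem opD_comm (A B : Matrix ι ι ℝ) : opD A * opD B - opD B * opD A = opD (B * A - A * B) := by
  refine LinearMap.ext fun f => ?_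
  change dirDeriv A (dirDeriv B f) - dirDeriv B (dirDeriv A f) = dirDeriv (B * A - A * B) f
  have hsub : dirDeriv (B * A - A * B) f = dirDeriv (B * A) f - dirDeriv (A * B) f := by
    simp only [dirDeriv_apply, Matrix.sub_apply, sub_smul, Finset.sum_sub_distrib]
  have hsymm : ∑ k, ∑ j, ∑ i, ∑ l, (B k j * A i l) • (X j * X l * pderiv ℝ i (pderiv ℝ k f)) =
      ∑ k, ∑ j, ∑ i, ∑ l, (A k j * B i l) • (X j * X l * pderiv ℝ i (pderiv ℝ k f)) := by
    simp only [← Fintype.sum_prod_type' (fun (k j : ι) => ∑ i, ∑ l, _)]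
    simp only [← Fintype.sum_prod_type' (fun (i l : ι) => _)]
    rw [Finset.sum_comm]
    refine Finset.sum_congr rfl fun s _ => Finset.sum_congr rfl fun t _ => ?_
    rw [mul_comm (B _ _), mul_comm (X t.2), pderiv_comm]
  rw [dirDeriv_dirDeriv, dirDeriv_dirDeriv, hsymm, hsub]
  abel

theorem opD_smul (r : ℝ) (A : Matrix ι ι ℝ) : opD (r • A) = r • opD A := by
  refine LinearMap.ext fun f => ?_
  change dirDeriv (r • A) f = r • dirDeriv A f
  simp only [dirDeriv_apply, Finset.smul_sum, Matrix.smul_apply, smul_smul, smul_eq_mul]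

/-- A linear vector field trades one variable for another, so only finitely many coefficients of `f`
reach a given monomial. -/
theorem scalarCoeff_comp_opD_mem (A : Matrix ι ι ℝ) (m : ι →₀ ℕ) :
    scalarCoeff m ∘ₗ opD A ∈ Submodule.span ℝ (Set.range (scalarCoeff (ι := ι))) := by
  have h : scalarCoeff m ∘ₗ opD A = ∑ i, ∑ j, (if Finsupp.single j 1 ≤ m then
      (A i j * (((m - Finsupp.single j 1 : ι →₀ ℕ) i : ℝ) + 1)) •
        scalarCoeff (m - Finsupp.single j 1 + Finsupp.single i 1) else 0) := by
    refine LinearMap.ext fun f => ?_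
    change coeff m (dirDeriv A f) = _
    rw [dirDeriv_apply]
    simp only [map_sum, LinearMap.sum_apply]
    refine Finset.sum_congr rfl fun i _ => Finset.sum_congr rfl fun j _ => ?_
    rw [LinearMap.map_smul, X_def, coeff_monomial_mul]
    split_ifs with hm
    · rw [coeff_pderiv]
      simp only [LinearMap.smul_apply, smul_eq_mul, scalarCoeff]
      ring
    · simp
  rw [h]
  refine Submodule.sum_mem _ fun i _ => Submodule.sum_mem _ fun j _ => ?_
  split_ifs
  · exact Submodule.smul_mem _ _ (Submodule.subset_span ⟨_, rfl⟩)
  · exact Submodule.zero_mem _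

theorem fischerWeight_add_single (c : ι → ℝ) (m : ι →₀ ℕ) (i : ι) :
    fischerWeight c (m + Finsupp.single i 1) = c i * ((m i : ℝ) + 1) * fischerWeight c m := by
  rw [fischerWeight, fischerWeight, ← Finset.mul_prod_erase _ _ (Finset.mem_univ i),
    ← Finset.mul_prod_erase _ _ (Finset.mem_univ i)]
  have h : ∏ x ∈ Finset.univ.erase i, c x ^ (m + Finsupp.single i 1 : ι →₀ ℕ) x *
      (((m + Finsupp.single i 1 : ι →₀ ℕ) x).factorial : ℝ) =
      ∏ x ∈ Finset.univ.erase i, c x ^ m x * ((m x).factorial : ℝ) := by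
    refine Finset.prod_congr rfl fun x hx => ?_
    rw [Finsupp.add_apply, Finsupp.single_eq_of_ne (Finset.ne_of_mem_erase hx), add_zero]
  rw [h, Finsupp.add_apply, Finsupp.single_eq_same, Nat.factorial_succ, pow_succ]
  push_cast
  ring

/-- The weighted Fischer form on the homogeneous components of degree `g`. -/
def fischer (c : ι → ℝ) (g : ℕ) : MvPowerSeries ι ℝ →ₗ[ℝ] MvPowerSeries ι ℝ →ₗ[ℝ] ℝ :=
  ∑ m ∈ Finset.univ.finsuppAntidiag g,
    fischerWeight c m • (LinearMap.mul ℝ ℝ).compl₁₂ (scalarCoeff m) (scalarCoeff m)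

theorem fischer_apply (c : ι → ℝ) (g : ℕ) (u v : MvPowerSeries ι ℝ) :
    fischer c g u v = ∑ m ∈ Finset.univ.finsuppAntidiag g,
      fischerWeight c m * (coeff m u * coeff m v) := by
  simp [fischer, LinearMap.sum_apply, scalarCoeff]

theorem fischer_symm (c : ι → ℝ) (g : ℕ) (u v : MvPowerSeries ι ℝ) :
    fischer c g u v = fischer c g v u := by
  simp only [fischer_apply, mul_comm (coeff _ u)]

theorem fischer_zero_X_mul (c : ι → ℝ) (i : ι) (p h : MvPowerSeries ι ℝ) :
    fischer c 0 (X i * p) h = 0 := by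
  rw [fischer_apply]
  refine Finset.sum_eq_zero fun m hm => ?_
  have : m = 0 := by
    ext k
    have h1 := (Finset.mem_finsuppAntidiag.1 hm).1
    simpa using Finset.sum_eq_zero_iff.1 h1 k (Finset.mem_univ k)
  rw [this, coeff_zero_X_mul, zero_mul, mul_zero]

/-- Multiplication by a variable and the derivative by it are adjoint up to a factor. -/
theorem fischer_succ_X_mul (c : ι → ℝ) (g : ℕ) (i : ι) (p h : MvPowerSeries ι ℝ) :
    fischer c (g + 1) (X i * p) h = c i * fischer c g p (pderiv ℝ i h) := by
  rw [fischer_apply, fischer_apply, Finset.mul_sum]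
  symm
  refine Finset.sum_of_injOn (fun m => m + Finsupp.single i 1)
    (fun _ _ _ _ h => add_right_cancel h) ?_ ?_ ?_
  · intro m hm
    have h1 := (Finset.mem_finsuppAntidiag.1 hm).1
    simp only [Finset.mem_coe, Finset.mem_finsuppAntidiag, Finsupp.coe_add, Pi.add_apply,
      Finset.sum_add_distrib, Finset.subset_univ, and_true]
    rw [h1]
    simp [Finsupp.single_apply]
  · intro m hm hm'
    -- Monomials outside the image of the shift are not divisible by `X i` and contribute nothing.
    rw [X_def, coeff_monomial_mul, if_neg, zero_mul, mul_zero]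
    intro hle
    refine hm' ⟨m - Finsupp.single i 1, ?_, tsub_add_cancel_of_le hle⟩
    have h1 := (Finset.mem_finsuppAntidiag.1 hm).1
    rw [← tsub_add_cancel_of_le hle] at h1
    simp only [Finset.mem_coe, Finset.mem_finsuppAntidiag, Finset.subset_univ, and_true]
    simpa [Finsupp.single_apply, Finset.sum_add_distrib] using h1
  · intro m _
    rw [fischerWeight_add_single, coeff_pderiv, X_def, add_comm m, coeff_add_monomial_mul]
    ring

/-- Since `X i` is adjoint to `c i` times the `i`-th derivative, the adjoint of `X j ∂_i` is `(c j /
c i) X i ∂_j`; the hypothesis matches these ratios. -/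
theorem fischer_opD (c : ι → ℝ) {A A' : Matrix ι ι ℝ} (h : ∀ i j, A' j i * c i = A i j * c j)
    (g : ℕ) (u v : MvPowerSeries ι ℝ) : fischer c g (opD A u) v = fischer c g u (opD A' v) := by
  change fischer c g (dirDeriv A u) v = fischer c g u (dirDeriv A' v)
  rw [fischer_symm c g u]
  simp only [dirDeriv_apply, map_sum, LinearMap.sum_apply, map_smul, LinearMap.smul_apply,
    smul_eq_mul]
  cases g with
  | zero => simp [fischer_zero_X_mul]
  | succ g =>
    simp only [fischer_succ_X_mul]
    rw [Finset.sum_comm]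
    refine Finset.sum_congr rfl fun j _ => Finset.sum_congr rfl fun i _ => ?_
    rw [← mul_assoc, ← h, mul_assoc, fischer_symm]

theorem isUnitarizable_opD {N M H : Matrix ι ι ℝ} (hT : IsTriad N M H) (hH : H.transpose = H)
    {c : ι → ℝ} (hc : ∀ i, 0 < c i) (hNM : ∀ i j, M i j * c i = N j i * c j) :
    IsUnitarizable scalarCoeff (opD N.transpose) (opD M.transpose) (opD H) (fischer c) where
  comm_XY := by
    rw [opD_comm, ← Matrix.transpose_mul, ← Matrix.transpose_mul, ← Matrix.transpose_sub,
      hT.comm_XY, hH]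
  comm_ZY := by
    rw [opD_comm, ← opD_smul, ← Matrix.transpose_smul, ← hT.comm_ZY, Matrix.transpose_sub,
      Matrix.transpose_mul, Matrix.transpose_mul, hH]
  separating x hx := MvPowerSeries.ext fun m => hx m
  full g := ⟨g, fun _ => rfl⟩
  finitary_X := scalarCoeff_comp_opD_mem _
  finitary_Y := scalarCoeff_comp_opD_mem _
  finitary_form g u := by
    have : fischer c g u = ∑ m ∈ Finset.univ.finsuppAntidiag g,
        (fischerWeight c m * coeff m u) • scalarCoeff m := by
      refine LinearMap.ext fun v => ?_
      simp [fischer_apply, LinearMap.sum_apply, scalarCoeff, mul_assoc]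
    rw [this]
    exact Submodule.sum_mem _ fun m _ => Submodule.smul_mem _ _ (Submodule.subset_span ⟨m, rfl⟩)
  form_symm := fischer_symm c
  form_nonneg g u := by
    rw [fischer_apply]
    exact Finset.sum_nonneg fun m _ => mul_nonneg (fischerWeight_pos hc m).le (mul_self_nonneg _)
  form_definite u hu := by
    refine MvPowerSeries.ext fun m => ?_
    have h := hu (∑ i, m i)
    rw [fischer_apply, Finset.sum_eq_zero_iff_of_nonneg fun m _ =>
      mul_nonneg (fischerWeight_pos hc m).le (mul_self_nonneg _)] at h
    have h1 := h m (by simp [Finset.mem_finsuppAntidiag])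
    simpa [(fischerWeight_pos hc m).ne'] using h1
  form_adjoint := fischer_opD c fun i j => by
    simpa [Matrix.transpose_apply] using hNM i j

end PowerSeries

/-! ### Uniqueness of the triad, by positivity of traces. -/

section TriadUnique

variable {ι : Type*} [Fintype ι] [DecidableEq ι]

open Matrix

theorem trace_weighted (c : ι → ℝ) (A : Matrix ι ι ℝ) :
    (Aᵀ * diagonal c * A * diagonal c⁻¹).trace = ∑ j, ∑ i, c i * A i j ^ 2 * (c j)⁻¹ := by
  simp only [trace, diag_apply, mul_diagonal, Pi.inv_apply]
  refine Finset.sum_congr rfl fun j _ => ?_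
  rw [mul_apply, Finset.sum_mul]
  refine Finset.sum_congr rfl fun i _ => ?_
  rw [mul_diagonal, transpose_apply]
  ring

/-- The difference `K = H - H₀` commutes with `N` and is a commutator `[N, M - M₀]`, so `tr (K K) =
0`. Symmetry of `K` turns this into the vanishing of a sum of squares. -/
theorem IsTriad.third_unique {N M M₀ H H₀ : Matrix ι ι ℝ} (h : IsTriad N M H)
    (h₀ : IsTriad N M₀ H₀) (hH : Hᵀ = H) (hH₀ : H₀ᵀ = H₀) : H = H₀ := by
  have hK : (H - H₀) * N = N * (H - H₀) := by
    have := h.comm_ZX.trans h₀.comm_ZX.symm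
    rw [sub_mul, mul_sub, sub_eq_sub_iff_sub_eq_sub]
    exact this
  have hKD : H - H₀ = N * (M - M₀) - (M - M₀) * N := by
    rw [← h.comm_XY, ← h₀.comm_XY]
    noncomm_ring
  have htr : ((H - H₀)ᴴ * (H - H₀)).trace = 0 := by
    rw [conjTranspose_eq_transpose_of_trivial, transpose_sub, hH, hH₀]
    nth_rw 2 [hKD]
    rw [mul_sub, trace_sub, ← mul_assoc, hK, mul_assoc, trace_mul_comm, mul_assoc, sub_self]
  exact sub_eq_zero.1 (trace_conjTranspose_mul_self_eq_zero_iff.1 htr)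

/-- `D = M - M₀` is a top vector of weight `-2` in the adjoint representation. For the form `tr (Aᵀ
C B C⁻¹)`, with `C = diagonal c`, bracketing with `M₀` is adjoint to bracketing with `N`, so `E =
[M₀, D]` satisfies `⟨E, E⟩ = ⟨D, [N, E]⟩ = -2 ⟨D, D⟩`. Positivity gives `D = 0`. -/
theorem IsTriad.second_unique {N M M₀ H : Matrix ι ι ℝ} (h : IsTriad N M H)
    (h₀ : IsTriad N M₀ H) {c : ι → ℝ} (hc : ∀ i, 0 < c i)
    (hNM : ∀ i j, M₀ i j * c i = N j i * c j) : M = M₀ := by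
  set D := M - M₀ with hD
  set E := M₀ * D - D * M₀ with hE
  have hND : N * D = D * N := by
    have := h.comm_XY.trans h₀.comm_XY.symm
    rw [hD, sub_mul, mul_sub, sub_eq_sub_iff_sub_eq_sub]
    exact this
  have hHD : H * D - D * H = (-2 : ℝ) • D := by
    rw [hD, smul_sub, ← h.comm_ZY, ← h₀.comm_ZY]
    noncomm_ring
  have hNE : N * E - E * N = (-2 : ℝ) • D := by
    rw [← hHD, ← h₀.comm_XY, hE]
    simp only [mul_sub, sub_mul, mul_assoc, hND]
    simp only [← mul_assoc, hND]
    abel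
  have hG : M₀ᵀ * diagonal c = diagonal c * N := by
    ext i j
    rw [mul_diagonal, diagonal_mul, transpose_apply, hNM, mul_comm]
  have hG' : diagonal c⁻¹ * M₀ᵀ = N * diagonal c⁻¹ := by
    ext i j
    rw [mul_diagonal, diagonal_mul, transpose_apply, Pi.inv_apply, Pi.inv_apply]
    have := hNM j i
    have := (hc i).ne'
    have := (hc j).ne'
    field_simp
    linarith
  have hEG : Eᵀ * diagonal c = Dᵀ * diagonal c * N - M₀ᵀ * (Dᵀ * diagonal c) := by
    rw [hE, transpose_sub, transpose_mul, transpose_mul, sub_mul, mul_assoc, hG]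
    simp only [mul_assoc]
  have hq : (Eᵀ * diagonal c * E * diagonal c⁻¹).trace =
      -2 * (Dᵀ * diagonal c * D * diagonal c⁻¹).trace := by
    rw [hEG, sub_mul, sub_mul, trace_sub]
    have h1 : (M₀ᵀ * (Dᵀ * diagonal c) * E * diagonal c⁻¹).trace =
        (Dᵀ * diagonal c * (E * N) * diagonal c⁻¹).trace := by
      simp only [mul_assoc]
      rw [trace_mul_comm]
      simp only [mul_assoc]
      rw [hG']
    rw [h1, ← trace_sub, mul_assoc (Dᵀ * diagonal c) N, ← sub_mul, ← mul_sub, hNE, mul_smul_comm,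
      smul_mul_assoc, trace_smul, smul_eq_mul]
  have hnn : ∀ A : Matrix ι ι ℝ, ∀ i j, 0 ≤ c i * A i j ^ 2 * (c j)⁻¹ := fun A i j =>
    mul_nonneg (mul_nonneg (hc i).le (sq_nonneg _)) (inv_nonneg.2 (hc j).le)
  rw [trace_weighted, trace_weighted] at hq
  have h1 : 0 ≤ ∑ j, ∑ i, c i * E i j ^ 2 * (c j)⁻¹ :=
    Finset.sum_nonneg fun j _ => Finset.sum_nonneg fun i _ => hnn E i j
  have h2 : 0 ≤ ∑ j, ∑ i, c i * D i j ^ 2 * (c j)⁻¹ :=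
    Finset.sum_nonneg fun j _ => Finset.sum_nonneg fun i _ => hnn D i j
  have h3 : ∑ j, ∑ i, c i * D i j ^ 2 * (c j)⁻¹ = 0 := by linarith
  refine sub_eq_zero.1 (Matrix.ext fun i j => ?_)
  rw [Finset.sum_eq_zero_iff_of_nonneg fun j _ => Finset.sum_nonneg fun i _ => hnn D i j] at h3
  have h4 := h3 j (Finset.mem_univ j)
  rw [Finset.sum_eq_zero_iff_of_nonneg fun i _ => hnn D i j] at h4
  have h5 := h4 i (Finset.mem_univ i)
  change D i j = 0
  simpa [(hc i).ne', (hc j).ne'] using h5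

end TriadUnique

/-! ### The standard triad of a Jordan matrix. -/

section Standard

open Matrix

/-- The lowering matrix of the standard triad of a single block. -/
def lowerBlock (m : ℕ) : Matrix (Fin m) (Fin m) ℝ :=
  of fun a b => if (a : ℕ) = (b : ℕ) + 1 then ((b : ℝ) + 1) * (m - 1 - b) else 0

/-- The weights of the standard triad of a single block. -/
def weightBlock (m : ℕ) (a : Fin m) : ℝ := m - 1 - 2 * a

theorem jordanBlock_mul_apply {m : ℕ} (A : Matrix (Fin m) (Fin m) ℝ) (a b : Fin m) :
    (jordanBlock m * A) a b = if h : (a : ℕ) + 1 < m then A ⟨a + 1, h⟩ b else 0 := by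
  rw [mul_apply]
  split_ifs with h
  · rw [Finset.sum_eq_single ⟨a + 1, h⟩]
    · simp [jordanBlock]
    · intro x _ hx
      have : (a : ℕ) + 1 ≠ x := fun e => hx (Fin.ext e.symm)
      simp [jordanBlock, this]
    · simp
  · refine Finset.sum_eq_zero fun x _ => ?_
    have : (a : ℕ) + 1 ≠ x := by omega
    simp [jordanBlock, this]

theorem mul_jordanBlock_apply {m : ℕ} (A : Matrix (Fin m) (Fin m) ℝ) (a b : Fin m) :
    (A * jordanBlock m) a b = if 0 < (b : ℕ) then A a ⟨b - 1, by omega⟩ else 0 := by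
  rw [mul_apply]
  split_ifs with h
  · rw [Finset.sum_eq_single ⟨b - 1, by omega⟩]
    · simp [jordanBlock, Nat.sub_add_cancel h]
    · intro x _ hx
      have : (x : ℕ) + 1 ≠ b := fun e => hx (Fin.ext (by simp only; omega))
      simp [jordanBlock, this]
    · simp
  · refine Finset.sum_eq_zero fun x _ => ?_
    have : (x : ℕ) + 1 ≠ b := by omega
    simp [jordanBlock, this]

theorem isTriad_block (m : ℕ) :
    IsTriad (jordanBlock m) (lowerBlock m) (diagonal (weightBlock m)) where
  comm_XY := by
    ext a b
    rw [Matrix.sub_apply, jordanBlock_mul_apply, mul_jordanBlock_apply, diagonal_apply]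
    simp only [lowerBlock, of_apply, weightBlock, Fin.ext_iff]
    by_cases hab : (a : ℕ) = b
    · have ha := a.2
      have e : (a : ℝ) = b := by exact_mod_cast hab
      by_cases h0 : 0 < (b : ℕ)
      · have hb : (a : ℕ) = b - 1 + 1 := by omega
        have eb : ((b - 1 : ℕ) : ℝ) = b - 1 := by
          rw [Nat.cast_sub h0, Nat.cast_one]
        by_cases h1 : (a : ℕ) + 1 < m
        · rw [dif_pos h1, if_pos (by omega), if_pos h0, if_pos hb, if_pos hab, eb, e]
          ring
        · have em : (m : ℝ) = b + 1 := by
            have : m = b + 1 := by omega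
            exact_mod_cast this
          rw [dif_neg h1, if_pos h0, if_pos hb, if_pos hab, eb, e, em]
          ring
      · have eb : (b : ℝ) = 0 := by
          have : (b : ℕ) = 0 := by omega
          exact_mod_cast this
        by_cases h1 : (a : ℕ) + 1 < m
        · rw [dif_pos h1, if_pos (by omega), if_neg h0, if_pos hab, e, eb]
          ring
        · have em : (m : ℝ) = 1 := by
            have : m = 1 := by omega
            exact_mod_cast this
          rw [dif_neg h1, if_neg h0, if_pos hab, e, eb, em]
          ring
    · rw [if_neg hab]
      have h1 : ¬ (a : ℕ) + 1 = b + 1 := by omega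
      simp only [h1, if_false]
      by_cases h0 : 0 < (b : ℕ)
      · have h2 : ¬ (a : ℕ) = b - 1 + 1 := by omega
        simp [h2]
      · simp [h0]
  comm_ZX := by
    ext a b
    rw [Matrix.sub_apply, diagonal_mul, mul_diagonal]
    simp only [jordanBlock, of_apply, weightBlock, Matrix.smul_apply, smul_eq_mul]
    split_ifs with h
    · have e : (b : ℝ) = a + 1 := by exact_mod_cast h.symm
      rw [e]
      ring
    · ring
  comm_ZY := by
    ext a b
    rw [Matrix.sub_apply, diagonal_mul, mul_diagonal]
    simp only [lowerBlock, of_apply, weightBlock, Matrix.smul_apply, smul_eq_mul]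
    split_ifs with h
    · have e : (a : ℝ) = b + 1 := by exact_mod_cast h
      rw [e]
      ring
    · ring

variable {q : ℕ} (d : Fin q → ℕ)

/-- The lowering matrix of the standard triad with blocks of sizes `d`. -/
def lowerM : Matrix (Coord d) (Coord d) ℝ := blockDiagonal' fun j => lowerBlock (d j)

/-- The weights of the standard triad with blocks of sizes `d`. -/
def stdWeight (i : Coord d) : ℝ := weightBlock (d i.1) i.2

theorem isTriad_standard : IsTriad (jordanN d) (lowerM d) (diagonal (stdWeight d)) := by
  have hd : diagonal (stdWeight d) = blockDiagonal' fun j => diagonal (weightBlock (d j)) :=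
    (blockDiagonal'_diagonal fun j => weightBlock (d j)).symm
  rw [hd]
  refine ⟨?_, ?_, ?_⟩
  · rw [jordanN, lowerM, ← blockDiagonal'_mul, ← blockDiagonal'_mul, ← blockDiagonal'_sub]
    exact congrArg _ (funext fun j => (isTriad_block (d j)).comm_XY)
  · rw [jordanN, ← blockDiagonal'_mul, ← blockDiagonal'_mul, ← blockDiagonal'_sub,
      ← blockDiagonal'_smul]
    exact congrArg _ (funext fun j => (isTriad_block (d j)).comm_ZX)
  · rw [lowerM, ← blockDiagonal'_mul, ← blockDiagonal'_mul, ← blockDiagonal'_sub,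
      ← blockDiagonal'_smul]
    exact congrArg _ (funext fun j => (isTriad_block (d j)).comm_ZY)

/-- The weights on the coordinates for which `lowerM` is the adjoint of `jordanN`. -/
def fischerCoord (i : Coord d) : ℝ :=
  ((d i.1 - 1 - i.2 : ℕ).factorial : ℝ) / ((i.2 : ℕ).factorial : ℝ)

theorem fischerCoord_pos (i : Coord d) : 0 < fischerCoord d i :=
  div_pos (by positivity) (by positivity)

theorem lowerM_mul_fischerCoord (i j : Coord d) :
    lowerM d i j * fischerCoord d i = jordanN d j i * fischerCoord d j := by
  obtain ⟨i, a⟩ := i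
  obtain ⟨j, b⟩ := j
  by_cases hij : i = j
  · subst hij
    rw [lowerM, jordanN, blockDiagonal'_apply_eq, blockDiagonal'_apply_eq]
    simp only [lowerBlock, jordanBlock, of_apply, fischerCoord]
    by_cases h : (a : ℕ) = b + 1
    · rw [if_pos h, if_pos h.symm, h]
      have ha := a.2
      obtain ⟨r, hr⟩ : ∃ r, d i = b + 2 + r := ⟨d i - (b + 2), by omega⟩
      have e1 : d i - 1 - (b + 1) = r := by omega
      have e2 : d i - 1 - b = r + 1 := by omega
      have e3 : (d i : ℝ) = b + 2 + r := by exact_mod_cast hr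
      rw [e1, e2, e3, Nat.factorial_succ, Nat.factorial_succ]
      push_cast
      field_simp
      ring
    · rw [if_neg h, if_neg fun e => h e.symm]
      simp
  · rw [lowerM, jordanN, blockDiagonal'_apply_ne _ _ _ hij, blockDiagonal'_apply_ne _ _ _
      (Ne.symm hij), zero_mul, zero_mul]

variable {d}

/-- A triad with first member `jordanN d` and symmetric third member is the standard one. -/
theorem IsTriad.eq_standard {M H : Matrix (Coord d) (Coord d) ℝ} (hT : IsTriad (jordanN d) M H)
    (hH : Hᵀ = H) : H = diagonal (stdWeight d) ∧ M = lowerM d := by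
  have h := hT.third_unique (isTriad_standard d) hH (diagonal_transpose _)
  subst h
  exact ⟨rfl, hT.second_unique (isTriad_standard d) (fischerCoord_pos d)
    (lowerM_mul_fischerCoord d)⟩

theorem sum_jordanN_transpose_smul {V : Type*} [AddCommGroup V] [Module ℝ V] (v : Coord d → V)
    (j : Fin q) (a : Fin (d j)) :
    ∑ l, (jordanN d)ᵀ ⟨j, a⟩ l • v l =
      if 0 < (a : ℕ) then v ⟨j, ⟨a - 1, by omega⟩⟩ else 0 := by
  have hzero : ∀ l : Coord d, (∀ h : 0 < (a : ℕ), l ≠ ⟨j, ⟨a - 1, by omega⟩⟩) →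
      (jordanN d)ᵀ ⟨j, a⟩ l = 0 := by
    rintro ⟨k, b⟩ hl
    rw [transpose_apply, jordanN]
    by_cases hk : k = j
    · subst hk
      rw [blockDiagonal'_apply_eq, jordanBlock, of_apply, if_neg]
      intro hb
      refine hl (by omega) ?_
      congr 1
      exact Fin.ext (by simp only; omega)
    · exact blockDiagonal'_apply_ne _ _ _ hk
  split_ifs with h
  · rw [Finset.sum_eq_single ⟨j, ⟨a - 1, by omega⟩⟩]
    · rw [transpose_apply, jordanN, blockDiagonal'_apply_eq, jordanBlock, of_apply,
        if_pos (by simp only; omega), one_smul]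
    · intro l _ hl
      rw [hzero l fun _ => hl, zero_smul]
    · simp
  · exact Finset.sum_eq_zero fun l _ => by rw [hzero l fun h' => absurd h' h, zero_smul]

variable (hd : ∀ j, 0 < d j)

/-- The index of the bottom row of the `j`-th block. -/
def bottomIdx (j : Fin q) : Coord d := ⟨j, ⟨d j - 1, Nat.sub_lt (hd j) Nat.one_pos⟩⟩

theorem bottom_apply_bottomIdx (j j' : Fin q) :
    bottom d hd j (bottomIdx hd j') = if j = j' then 1 else 0 := by
  rw [bottom, bottomIdx]
  by_cases h : j = j'
  · subst h
    simp
  · rw [if_neg h, Pi.single_eq_of_ne]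
    exact fun e => h (congrArg Sigma.fst e).symm

/-- The bottom row of each block of `lowerM` transposed is zero; this leaves a single term in the
bottom components of a transvectant. -/
theorem lowerM_transpose_mulVec_bottomIdx (u : Coord d → ℝ) (j : Fin q) :
    (-(lowerM d)ᵀ).mulVec u (bottomIdx hd j) = 0 := by
  rw [mulVec, dotProduct]
  refine Finset.sum_eq_zero fun l _ => ?_
  obtain ⟨k, b⟩ := l
  rw [neg_apply, transpose_apply, lowerM, bottomIdx]
  by_cases hk : k = j
  · subst hk
    have : (b : ℕ) ≠ d k - 1 + 1 := by omega
    rw [blockDiagonal'_apply_eq, lowerBlock, of_apply, if_neg this, neg_zero, zero_mul]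
  · rw [blockDiagonal'_apply_ne _ _ _ hk, neg_zero, zero_mul]

theorem toLin'_neg_stdWeight_bottom (j : Fin q) :
    Matrix.toLin' (-diagonal (stdWeight d)) (bottom d hd j) =
      ((d j - 1 : ℕ) : ℝ) • bottom d hd j := by
  rw [toLin'_apply, neg_mulVec]
  ext i
  rw [Pi.neg_apply, mulVec_diagonal, Pi.smul_apply, smul_eq_mul, bottom]
  by_cases h : i = bottomIdx hd j
  · subst h
    have e : ((d j - 1 : ℕ) : ℝ) = d j - 1 := by rw [Nat.cast_sub (hd j), Nat.cast_one]
    simp only [stdWeight, weightBlock, bottomIdx, Pi.single_eq_same, e]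
    ring
  · have h' : i ≠ ⟨j, ⟨d j - 1, Nat.sub_lt (hd j) Nat.one_pos⟩⟩ := h
    rw [Pi.single_eq_of_ne h']
    simp

theorem jordanN_transpose_mulVec_bottom (j : Fin q) :
    (jordanN d)ᵀ.mulVec (bottom d hd j) = 0 := by
  ext ⟨k, a⟩
  have h := sum_jordanN_transpose_smul (bottom d hd j) k a
  rw [mulVec, dotProduct]
  simp only [smul_eq_mul] at h
  rw [h]
  split_ifs with h0
  · rw [bottom, Pi.single_eq_of_ne, Pi.zero_apply]
    intro e
    obtain ⟨rfl, e⟩ := Sigma.mk.inj_iff.1 e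
    have := congrArg Fin.val (eq_of_heq e)
    simp only at this
    omega
  · rfl

end Standard

/-! ### Natural-number weights. -/

section Weights

variable {V : Type*} [AddCommGroup V] [Module ℝ V]

theorem apply_eq_weight_smul {T : Module.End ℝ V} {v : V} (h : ∃ n : ℕ, T v = (n : ℝ) • v) :
    T v = (weight T v : ℝ) • v :=
  Nat.sInf_mem (s := {w : ℕ | T v = (w : ℝ) • v}) h

theorem weight_eq {T : Module.End ℝ V} {v : V} (hv : v ≠ 0) {n : ℕ} (h : T v = (n : ℝ) • v) :
    weight T v = n := by
  have h1 := (apply_eq_weight_smul ⟨n, h⟩).symm.trans h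
  exact_mod_cast smul_left_injective ℝ hv h1

end Weights

/-! ### Monomials in the Hilbert basis are weight vectors. -/

section Invariants

variable {ι : Type*} [Fintype ι] [DecidableEq ι]

theorem exists_opD_monomialIn {H : Matrix ι ι ℝ} {p : ℕ} {α : Fin p → MvPolynomial ι ℝ}
    (hα : ∀ i, ∃ μ : ℝ, opD H (α i : MvPowerSeries ι ℝ) = μ • (α i : MvPowerSeries ι ℝ))
    (k : Fin p → ℕ) : ∃ μ : ℝ, opD H (monomialIn α k) = μ • monomialIn α k := by
  -- By the Leibniz rule the eigenvalues of a derivation add under products.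
  let S : Submonoid (MvPowerSeries ι ℝ) :=
    { carrier := {f | ∃ μ : ℝ, dirDeriv H f = μ • f}
      one_mem' := ⟨0, by simp⟩
      mul_mem' := by
        rintro f g ⟨μ, hf⟩ ⟨ν, hg⟩
        refine ⟨μ + ν, ?_⟩
        rw [Derivation.leibniz, hf, hg, smul_eq_mul, smul_eq_mul, mul_smul_comm, mul_smul_comm,
          mul_comm g, ← add_smul, add_comm] }
  have h : monomialIn α k ∈ S := by
    have e : monomialIn α k = ∏ i, (α i : MvPowerSeries ι ℝ) ^ k i := by
      rw [monomialIn, ← MvPolynomial.coeToMvPowerSeries.ringHom_apply, map_prod]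
      simp
    rw [e]
    exact Submonoid.prod_mem S fun i _ => Submonoid.pow_mem S (hα i) _
  exact h

end Invariants

/-! ### Transvectants are equivariants. -/

section Transvectant

variable {ι : Type*} [Fintype ι] [DecidableEq ι]

theorem coeffW_ne_zero (a b s j : ℕ) (hj : j ≤ s) : coeffW a b s j ≠ 0 := by
  have h : (s.choose j : ℝ) ≠ 0 := by exact_mod_cast (Nat.choose_pos hj).ne'
  unfold coeffW
  positivity

/-- This recursion is what defines the coefficients: it makes raising `𝒴^(j+1) f` in one term cancel
raising the vector factor in the preceding term. The right side is written with `s - (j + 1)` to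
match the factor in `raise_lowering`. -/
theorem coeffW_succ {a b s j : ℕ} (hj : j < s) (ha : s ≤ a) (hb : s ≤ b) :
    coeffW a b s (j + 1) * ((j + 1) * (a - j)) =
      coeffW a b s j * (((s - (j + 1) : ℕ) + 1) * (b - (s - (j + 1) : ℕ))) := by
  obtain ⟨r, rfl⟩ := Nat.exists_eq_add_of_lt hj
  obtain ⟨u, rfl⟩ := Nat.exists_eq_add_of_le ha
  obtain ⟨v, rfl⟩ := Nat.exists_eq_add_of_le hb
  have e1 : j + r + 1 + u - (j + 1) = r + u := by omega
  have e2 : j + r + 1 + u - j = r + u + 1 := by omega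
  have e3 : j + r + 1 + v - (j + r + 1) + (j + 1) = v + j + 1 := by omega
  have e4 : j + r + 1 + v - (j + r + 1) + j = v + j := by omega
  have e5 : j + r + 1 - (j + 1) = r := by omega
  have hc : ((j + r + 1).choose (j + 1) : ℝ) * (j + 1) = (j + r + 1).choose j * (r + 1) := by
    have := Nat.choose_succ_right_eq (j + r + 1) j
    have e : j + r + 1 - j = r + 1 := by omega
    rw [e] at this
    exact_mod_cast this
  unfold coeffW
  rw [e1, e2, e3, e4, e5, Nat.factorial_succ, Nat.factorial_succ]
  push_cast
  linear_combination ((r + u).factorial / (j + r + 1 + u - (j + r + 1) : ℕ).factorial *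
    ((v + j + 1) * (v + j).factorial / (j + r + 1 + v - (j + r + 1) : ℕ).factorial) *
      (r + u + 1) : ℝ) * hc

/-- The transvectant of two top weight vectors is an equivariant. -/
theorem lieOp_transvectant {N M H : Matrix ι ι ℝ} (hT : IsTriad N M H) (hH : H.transpose = H)
    {f : MvPowerSeries ι ℝ} {w : ι → ℝ} {s : ℕ} (hXf : opD N.transpose f = 0)
    (hZf : opD H f = (weight (opD H) f : ℝ) • f)
    (hXw : N.transpose.mulVec w = 0)
    (hZw : Matrix.toLin' (-H) w = (weight (Matrix.toLin' (-H)) w : ℝ) • w)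
    (hsf : s ≤ weight (opD H) f) (hsw : s ≤ weight (Matrix.toLin' (-H)) w) :
    lieOp N.transpose (transvectant M H f w s) = 0 := by
  have hXY : opD N.transpose * opD M.transpose - opD M.transpose * opD N.transpose = opD H := by
    rw [opD_comm, ← Matrix.transpose_mul, ← Matrix.transpose_mul, ← Matrix.transpose_sub,
      hT.comm_XY, hH]
  have hZY : opD H * opD M.transpose - opD M.transpose * opD H = (-2 : ℝ) • opD M.transpose := by
    rw [opD_comm, ← opD_smul, ← Matrix.transpose_smul, ← hT.comm_ZY, Matrix.transpose_sub,
      Matrix.transpose_mul, Matrix.transpose_mul, hH]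
  have hXY' : Matrix.toLin' (-N.transpose) * Matrix.toLin' (-M.transpose) -
      Matrix.toLin' (-M.transpose) * Matrix.toLin' (-N.transpose) = Matrix.toLin' (-H) := by
    rw [Module.End.mul_eq_comp, Module.End.mul_eq_comp, ← Matrix.toLin'_mul, ← Matrix.toLin'_mul,
      ← map_sub]
    congr 1
    rw [neg_mul_neg, neg_mul_neg, ← Matrix.transpose_mul, ← Matrix.transpose_mul, ← neg_sub,
      ← Matrix.transpose_sub, hT.comm_XY, hH]
  have hZY' : Matrix.toLin' (-H) * Matrix.toLin' (-M.transpose) -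
      Matrix.toLin' (-M.transpose) * Matrix.toLin' (-H) =
        (-2 : ℝ) • Matrix.toLin' (-M.transpose) := by
    rw [Module.End.mul_eq_comp, Module.End.mul_eq_comp, ← Matrix.toLin'_mul, ← Matrix.toLin'_mul,
      ← map_sub, ← map_smul]
    congr 1
    have := congrArg Matrix.transpose hT.comm_ZY
    rw [Matrix.transpose_sub, Matrix.transpose_mul, Matrix.transpose_mul, hH,
      Matrix.transpose_smul] at this
    rw [neg_mul_neg, neg_mul_neg, smul_neg, ← this, neg_sub]
  set a := weight (opD H) f
  set b := weight (Matrix.toLin' (-H)) w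
  set y : ℕ → ι → ℝ := fun j => ((-M.transpose) ^ j).mulVec w with hy
  have hNy : ∀ j i, ∑ l, N.transpose i l * y (j + 1) l = -(((j : ℝ) + 1) * (b - j) * y j i) := by
    intro j i
    have hXw' : Matrix.toLin' (-N.transpose) w = 0 := by
      rw [Matrix.toLin'_apply, Matrix.neg_mulVec, hXw, neg_zero]
    have h := congrFun (raise_lowering hXY' hZY' hXw' hZw j) i
    rw [← Matrix.toLin'_pow, ← Matrix.toLin'_pow, Matrix.toLin'_apply, Matrix.toLin'_apply,
      Matrix.toLin'_apply, Matrix.neg_mulVec, Pi.neg_apply, Pi.smul_apply, smul_eq_mul] at h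
    exact neg_eq_iff_eq_neg.1 h
  have hNy0 : ∀ i, ∑ l, N.transpose i l * y 0 l = 0 := by
    intro i
    have h := congrFun hXw i
    have h0 : y 0 = w := by simp [hy]
    rw [h0]
    exact h
  funext i
  change opD N.transpose (transvectant M H f w s i) -
    ∑ l, N.transpose i l • transvectant M H f w s l = 0
  -- The term `j = 0` drops out here because `𝒳 f = 0`, and in `h2` the term `j = s` drops out
  -- because `N* w = 0`. After the shift both sums run over the same products.
  have h1 : opD N.transpose (transvectant M H f w s i) = ∑ j ∈ Finset.range s,
      ((-1 : ℝ) ^ (j + 1) * coeffW a b s (j + 1) * y (s - (j + 1)) i * ((j + 1) * (a - j))) •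
        ((opD M.transpose) ^ j) f := by
    have e : transvectant M H f w s i = ∑ j ∈ Finset.range (s + 1),
        ((-1 : ℝ) ^ j * coeffW a b s j * y (s - j) i) • ((opD M.transpose) ^ j) f := rfl
    rw [e, map_sum, Finset.sum_range_succ', map_smul, pow_zero (opD _), Module.End.one_apply, hXf, smul_zero,
      add_zero]
    refine Finset.sum_congr rfl fun j _ => ?_
    rw [map_smul, raise_lowering hXY hZY hXf hZf, smul_smul]
  have h2 : ∑ l, N.transpose i l • transvectant M H f w s l = ∑ j ∈ Finset.range s,
      ((-1 : ℝ) ^ j * coeffW a b s j * -((((s - (j + 1) : ℕ) : ℝ) + 1) *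
        (b - (s - (j + 1) : ℕ)) * y (s - (j + 1)) i)) • ((opD M.transpose) ^ j) f := by
    have e : ∑ l, N.transpose i l • transvectant M H f w s l = ∑ j ∈ Finset.range (s + 1),
        ((-1 : ℝ) ^ j * coeffW a b s j * ∑ l, N.transpose i l * y (s - j) l) •
          ((opD M.transpose) ^ j) f := by
      simp only [transvectant, Finset.smul_sum]
      rw [Finset.sum_comm]
      refine Finset.sum_congr rfl fun j _ => ?_
      rw [Finset.mul_sum, Finset.sum_smul]
      refine Finset.sum_congr rfl fun l _ => ?_
      rw [smul_smul]
      congr 1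
      ring
    rw [e, Finset.sum_range_succ, Nat.sub_self, hNy0, mul_zero, zero_smul, add_zero]
    refine Finset.sum_congr rfl fun j hj => ?_
    have : s - j = s - (j + 1) + 1 := by
      have := Finset.mem_range.1 hj
      omega
    rw [this, hNy]
  rw [h1, h2, ← Finset.sum_sub_distrib]
  refine Finset.sum_eq_zero fun j hj => ?_
  rw [← sub_smul]
  have := coeffW_succ (Finset.mem_range.1 hj) hsf hsw
  have h0 : (-1 : ℝ) ^ (j + 1) * coeffW a b s (j + 1) * y (s - (j + 1)) i * ((j + 1) * (a - j)) -
      (-1 : ℝ) ^ j * coeffW a b s j * -((((s - (j + 1) : ℕ) : ℝ) + 1) *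
        (b - (s - (j + 1) : ℕ)) * y (s - (j + 1)) i) = 0 := by
    rw [pow_succ]
    linear_combination -((-1 : ℝ) ^ j * y (s - (j + 1)) i) * this
  rw [h0, zero_smul]

end Transvectant

/-! ### Reduction to the bottom components. -/

section Blocks

variable {q : ℕ} {d : Fin q → ℕ} (hd : ∀ j, 0 < d j)

/-- The components of an equivariant are determined by the bottom component of each block. -/
theorem equivariant_apply {v : FormalVF (Coord d)} (hv : lieOp (jordanN d).transpose v = 0)
    (j : Fin q) (r : ℕ) (hr : r < d j) :
    ((opD (jordanN d).transpose) ^ r) (v (bottomIdx hd j)) =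
      v ⟨j, ⟨d j - 1 - r, by omega⟩⟩ := by
  induction r with
  | zero => rfl
  | succ r ih =>
    rw [pow_succ', Module.End.mul_apply, ih (by omega)]
    have h := congrFun hv ⟨j, ⟨d j - 1 - r, by omega⟩⟩
    change opD (jordanN d).transpose _ - ∑ l, (jordanN d).transpose _ l • v l = 0 at h
    rw [sum_jordanN_transpose_smul, if_pos (by simp only; omega)] at h
    rw [sub_eq_zero.1 h]
    rfl

theorem equivariant_pow_apply_eq_zero {v : FormalVF (Coord d)}
    (hv : lieOp (jordanN d).transpose v = 0) (j : Fin q) :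
    ((opD (jordanN d).transpose) ^ d j) (v (bottomIdx hd j)) = 0 := by
  have e : d j = d j - 1 + 1 := by have := hd j; omega
  rw [e, pow_succ', Module.End.mul_apply, equivariant_apply hd hv j _ (by have := hd j; omega)]
  have h := congrFun hv ⟨j, ⟨d j - 1 - (d j - 1), by have := hd j; omega⟩⟩
  change opD (jordanN d).transpose _ - ∑ l, (jordanN d).transpose _ l • v l = 0 at h
  rw [sum_jordanN_transpose_smul, if_neg (by simp)] at h
  exact sub_eq_zero.1 h

/-- Only the last term of a transvectant contributes to the bottom components. -/
theorem transvectant_bottomIdx {H : Matrix (Coord d) (Coord d) ℝ} (f : MvPowerSeries (Coord d) ℝ)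
    (j j' : Fin q) (s : ℕ) :
    transvectant (lowerM d) H f (bottom d hd j) s (bottomIdx hd j') =
      if j = j' then ((-1 : ℝ) ^ s *
        coeffW (weight (opD H) f) (weight (Matrix.toLin' (-H)) (bottom d hd j)) s s) •
          ((opD (lowerM d).transpose) ^ s) f else 0 := by
  rw [transvectant, Finset.sum_range_succ, Finset.sum_eq_zero, zero_add, Nat.sub_self, pow_zero,
    Matrix.one_mulVec, bottom_apply_bottomIdx]
  · split_ifs <;> simp
  · intro i hi
    have : s - i = s - (i + 1) + 1 := by
      have := Finset.mem_range.1 hi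
      omega
    rw [this, pow_succ', ← Matrix.mulVec_mulVec, lowerM_transpose_mulVec_bottomIdx, mul_zero,
      zero_smul]

end Blocks

/-! ### Bottom components of the pre-box product. -/

section PreBox

variable {q : ℕ} {d : Fin q → ℕ} (hd : ∀ j, 0 < d j) {H : Matrix (Coord d) (Coord d) ℝ}
  {p : ℕ} {α : Fin p → MvPolynomial (Coord d) ℝ} {A : Set (Fin p → ℕ)}

/-- The nonzero factor in the bottom components of the transvectants. -/
def bottomFactor (t : Admissible H α A (bottom d hd)) : ℝ :=
  (-1 : ℝ) ^ t.1.2.2 * coeffW (weight (opD H) (monomialIn α t.1.1))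
    (weight (Matrix.toLin' (-H)) (bottom d hd t.1.2.1)) t.1.2.2 t.1.2.2

theorem bottomFactor_ne_zero (t : Admissible H α A (bottom d hd)) : bottomFactor hd t ≠ 0 :=
  mul_ne_zero (pow_ne_zero _ (by norm_num)) (coeffW_ne_zero _ _ _ _ le_rfl)

theorem preBox_bottomIdx (t : Admissible H α A (bottom d hd)) (j : Fin q) :
    preBox (lowerM d) H α A (bottom d hd) t (bottomIdx hd j) =
      if t.1.2.1 = j then bottomFactor hd t •
        ((opD (lowerM d).transpose) ^ t.1.2.2) (monomialIn α t.1.1) else 0 :=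
  transvectant_bottomIdx hd _ _ _ _

/-- Formal combinations of the bottom components in one block of the transvectants are formal
combinations of lowered invariants. -/
theorem isFormalComb_preBox_bottomIdx_iff
    (hw : ∀ j, weight (Matrix.toLin' (-H)) (bottom d hd j) = d j - 1) (j : Fin q)
    (C : Admissible H α A (bottom d hd) → ℝ) (c : A × ℕ → ℝ)
    (hC : ∀ t : Admissible H α A (bottom d hd), t.1.2.1 = j →
      C t * bottomFactor hd t = c (⟨t.1.1, t.2.1⟩, t.1.2.2))
    (hc : ∀ t, c t ≠ 0 → t.2 ≤ weight (opD H) (monomialIn α t.1) ∧ t.2 < d j)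
    (x : MvPowerSeries (Coord d) ℝ) :
    IsFormalComb scalarCoeff
        (fun t => preBox (lowerM d) H α A (bottom d hd) t (bottomIdx hd j)) C x ↔
      IsFormalComb scalarCoeff
        (fun t : A × ℕ => ((opD (lowerM d).transpose) ^ t.2) (monomialIn α t.1)) c x := by
  -- `T` embeds in both index sets, and outside it the terms vanish on both sides: transvectants
  -- from other blocks have zero component here, and `c` is zero by assumption.
  let T := {t : A × ℕ // t.2 ≤ weight (opD H) (monomialIn α t.1) ∧ t.2 < d j}
  let e : T → Admissible H α A (bottom d hd) := fun t =>
    ⟨(t.1.1, j, t.1.2), t.1.1.2, t.2.1, by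
      change t.1.2 ≤ weight (Matrix.toLin' (-H)) (bottom d hd j)
      rw [hw]
      have := t.2.2
      omega⟩
  have he : Function.Injective e := by
    intro t t' h
    have h' := congrArg Subtype.val h
    exact Subtype.ext (Prod.ext (Subtype.ext (congrArg Prod.fst h'))
      (congrArg (fun z => z.2.2) h'))
  have hval : Function.Injective (Subtype.val : T → A × ℕ) := Subtype.val_injective
  rw [← isFormalComb_comp_iff he, ← isFormalComb_comp_iff hval]
  · have hterm : ∀ t : T,
        C (e t) • preBox (lowerM d) H α A (bottom d hd) (e t) (bottomIdx hd j) =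
          c t.1 • ((opD (lowerM d).transpose) ^ t.1.2) (monomialIn α t.1.1) := by
      intro t
      have ht : (e t).1.2.1 = j := rfl
      rw [preBox_bottomIdx, if_pos ht, smul_smul, hC _ ht]
    exact ⟨fun h => h.congr hterm, fun h => h.congr fun t => (hterm t).symm⟩
  · intro t ht
    by_cases h0 : c t = 0
    · rw [h0, zero_smul]
    · exact absurd ⟨⟨t, hc t h0⟩, rfl⟩ ht
  · intro t ht
    rw [preBox_bottomIdx, if_neg, smul_zero]
    intro hj
    refine ht ⟨⟨(⟨t.1.1, t.2.1⟩, t.1.2.2), t.2.2.1, ?_⟩, ?_⟩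
    · have h1 := t.2.2.2
      rw [hw, hj] at h1
      have := hd j
      change t.1.2.2 < d j
      omega
    · exact Subtype.ext (Prod.ext rfl (Prod.ext hj.symm rfl))

end PreBox

end Boosting

end

/-! ### The main theorem. -/

open Boosting in
theorem theorem17p5 {q : ℕ} (d : Fin q → ℕ) (hd : ∀ j, 0 < d j)
    (M H : Matrix (Coord d) (Coord d) ℝ)
    (hT : IsTriad (jordanN d) M H) (hH : H.transpose = H)
    {p : ℕ} (α : Fin p → MvPolynomial (Coord d) ℝ) (hα : IsHilbertBasis (jordanN d) H α)
    (A : Set (Fin p → ℕ)) (hA : IsPreferred (jordanN d) α A) :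
    IsFormalBasis vectorCoeff (preBox M H α A (bottom d hd))
      (LinearMap.ker (lieOp (jordanN d).transpose)) := by
  classical
  obtain ⟨hH0, rfl⟩ := hT.eq_standard hH
  have U := isUnitarizable_opD hT hH (fischerCoord_pos d) (lowerM_mul_fischerCoord d)
  have hX : ∀ k : A, opD (jordanN d).transpose (monomialIn α k) = 0 := hA.mem
  have hZ : ∀ k : A, opD H (monomialIn α k) =
      (weight (opD H) (monomialIn α k) : ℝ) • monomialIn α k := by
    intro k
    obtain ⟨μ, hμ⟩ := exists_opD_monomialIn (H := H) (α := α)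
      (fun i => (hα.weightVector i).imp fun μ h => h.apply_eq_smul) k
    -- Preferred monomials are nonzero by linear independence, so their real eigenvalue is a natural
    -- number and agrees with `weight`.
    obtain ⟨n, rfl⟩ := U.exists_nat_weight (hA.linearIndependent.ne_zero k) (hX k) hμ
    exact apply_eq_weight_smul ⟨n, hμ⟩
  have hZw : ∀ j, Matrix.toLin' (-H) (bottom d hd j) = ((d j - 1 : ℕ) : ℝ) • bottom d hd j := by
    rw [hH0]
    exact toLin'_neg_stdWeight_bottom hd
  have hw : ∀ j, weight (Matrix.toLin' (-H)) (bottom d hd j) = d j - 1 := by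
    intro j
    refine weight_eq (fun h => ?_) (hZw j)
    have := congrFun h (bottomIdx hd j)
    simp [bottom_apply_bottomIdx] at this
  have hmem : ∀ t, lieOp (jordanN d).transpose
      (preBox (lowerM d) H α A (bottom d hd) t) = 0 := fun t =>
    lieOp_transvectant hT hH (hX ⟨t.1.1, t.2.1⟩) (hZ ⟨t.1.1, t.2.1⟩)
      (jordanN_transpose_mulVec_bottom hd _) (apply_eq_weight_smul ⟨_, hZw _⟩) t.2.2.1 t.2.2.2
  have hlt : ∀ t : Admissible H α A (bottom d hd), t.1.2.2 < d t.1.2.1 := by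
    intro t
    have h1 := t.2.2.2
    rw [hw] at h1
    have := hd t.1.2.1
    omega
  refine .of_existsUnique hmem fun v hv => ?_
  have hv0 : lieOp (jordanN d).transpose v = 0 := hv
  choose c hc hcv using fun j => U.exists_expansion hX hZ hA.existsUnique_comb (d j) _
    (equivariant_pow_apply_eq_zero hd hv0 j)
  let C : Admissible H α A (bottom d hd) → ℝ := fun t =>
    c t.1.2.1 (⟨t.1.1, t.2.1⟩, t.1.2.2) / bottomFactor hd t
  have hC : IsFormalComb vectorCoeff (preBox (lowerM d) H α A (bottom d hd)) C v := by
    have hi : ∀ i, IsFormalComb scalarCoeff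
        (fun t => preBox (lowerM d) H α A (bottom d hd) t i) C (v i) := by
      rintro ⟨j, a⟩
      have hj := (isFormalComb_preBox_bottomIdx_iff hd hw j C (c j) (by
        rintro t rfl
        exact div_mul_cancel₀ _ (bottomFactor_ne_zero hd t)) (hc j) _).2 (hcv j)
      have hr : d j - 1 - a < d j := by have := hd j; omega
      have ha : (⟨j, a⟩ : Coord d) = ⟨j, ⟨d j - 1 - (d j - 1 - a), by omega⟩⟩ :=
        congrArg (Sigma.mk j) (Fin.ext (by have := a.2; simp only; omega))
      -- Powers of `𝒳` carry the expansion from the bottom row up to row `a`, both in `v` and in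
      -- every transvectant.
      have h := hj.map (pow_comp_mem_span_range U.finitary_X (d j - 1 - a))
      simp only [equivariant_apply hd hv0 j _ hr, equivariant_apply hd (hmem _) j _ hr] at h
      rwa [ha]
    exact fun m => hi m.1 m.2
  refine ⟨C, hC, fun C' hC' => ?_⟩
  have hD := hC'.sub hC
  rw [sub_self] at hD
  rw [← sub_eq_zero]
  funext t
  set j := t.1.2.1 with hj
  -- The coefficient differences in the block of `t`, rescaled and extended by zero to inadmissible
  -- indices, expand `0` in lowered invariants.
  let c' : A × ℕ → ℝ := fun z =>
    if hz : (z.1.1, j, z.2) ∈ Admissible H α A (bottom d hd) then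
      (C' - C) ⟨_, hz⟩ * bottomFactor hd ⟨_, hz⟩ else 0
  have hc' : ∀ u : Admissible H α A (bottom d hd), u.1.2.1 = j →
      (C' - C) u * bottomFactor hd u = c' (⟨u.1.1, u.2.1⟩, u.1.2.2) := by
    rintro ⟨⟨k, i, s⟩, hu⟩ hi
    simp only at hi
    subst hi
    simp only [c']
    rw [dif_pos hu]
  have hsupp : ∀ z, c' z ≠ 0 → z.2 ≤ weight (opD H) (monomialIn α z.1) ∧ z.2 < d j := by
    intro z hz
    by_cases h : (z.1.1, j, z.2) ∈ Admissible H α A (bottom d hd)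
    · exact ⟨h.2.1, hlt ⟨_, h⟩⟩
    · exact absurd (dif_neg h) hz
  have h0 : IsFormalComb scalarCoeff
      (fun t => preBox (lowerM d) H α A (bottom d hd) t (bottomIdx hd j)) (C' - C) 0 :=
    fun m => hD (bottomIdx hd j, m)
  have hz := U.expansion_unique hX hZ hA.existsUnique_comb (d j) c' hsupp
    ((isFormalComb_preBox_bottomIdx_iff hd hw j _ c' hc' hsupp _).1 h0)
  have ht := hc' t hj.symm
  rw [hz] at ht
  exact (mul_eq_zero.1 ht).resolve_right (bottomFactor_ne_zero hd t)
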